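/- Let $d_x, d_y, r$ be nonnegative integers, $m=\min(d_x,d_y)$, and let $\mathcal M_r\subset\mathbb R^{d_y\times d_x}$ be the set of real matrices of rank at most $r$. Let $Q_0\in\mathbb R^{d_y\times d_x}$ with $Q_0\notin\mathcal M_r$, and let $h(P)=\|P-Q_0\|^2$, with $\|\cdot\|$ the Frobenius norm. A singular value decomposition (SVD) of $Q_0$ is a factorization $Q_0=U\Sigma V^T$ with $U\in\mathbb R^{d_y\times d_y}$, $V\in\mathbb R^{d_x\times d_x}$ orthogonal and $\Sigma\in\mathbb R^{d_y\times d_x}$ diagonal with diagonal entries $\sigma_1\ge\dots\ge\sigma_m\ge 0$. For $I\subseteq[m]=\{1,\dots,m\}$ let $\Sigma_I$ be obtained from $\Sigma$ by replacing the diagonal entries $\sigma_i$ with $i\notin I$ by $0$. A critical point of $h|_{\mathcal M_r}$ is a point $P\in\mathcal M_r$ near which $\mathcal M_r$ is a smooth embedded submanifold and at which the differential of $h|_{\mathcal M_r}$ vanishes; its Morse index is the number of negative eigenvalues (with multiplicity) of the Hessian matrix of $h|_{\mathcal M_r}$ in any smooth local parametrization of $\mathcal M_r$ at $P$. 1. The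 critical points of $h|_{\mathcal M_r}$ are exactly the matrices $U\Sigma_I V^T$, where $Q_0=U\Sigma V^T$ is an SVD and $I\subseteq[m]$ has exactly $r$ elements, with $\sigma_i>0$ for all $i\in I$. 2. The local minima of $h|_{\mathcal M_r}$ are exactly the matrices $U\Sigma_{[r]}V^T$, where $Q_0=U\Sigma V^T$ is an SVD and $[r]=\{1,\dots,r\}$. They are exactly the global minima of $h|_{\mathcal M_r}$. 3. Suppose that $\sigma_1,\dots,\sigma_m$ are pairwise distinct and positive, and fix an SVD $Q_0=U\Sigma V^T$. Then $h|_{\mathcal M_r}$ has exactly $\binom mr$ critical points, namely the matrices $Q_I=U\Sigma_I V^T$ for $I\subseteq[m]$ with $\#I=r$. Its unique local minimum, and its unique global minimum, is $Q_{[r]}$. The Morse index of $Q_I$ is $$\#\{(j,i)\in I\times([m]\setminus I)\;:\;j>i\}.$$ -/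

import Mathlib

open Filter Topology Matrix
open scoped ContDiff Matrix.Norms.Frobenius

namespace EckartYoung

section Manifold

variable {E : Type*} [NormedAddCommGroup E] [NormedSpace ℝ E]

/-- `φ` is a smooth local parametrization, of dimension `d`, of the set `S` around the point `P`:
`φ` is smooth near `0`, it sends `0` to `P`, it is an immersion at `0`, and it maps the
neighbourhoods of `0` onto the neighbourhoods of `P` in `S`. (An immersion is an embedding
near `0`, so `φ` restricts to a diffeomorphism from a neighbourhood of `0` onto a
relatively open neighbourhood of `P` in `S`.) -/
structure IsLocalParam (S : Set E) (P : E) {d : ℕ} (φ : EuclideanSpace ℝ (Fin d) → E) : Prop where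
  smooth : ∀ᶠ x in 𝓝 (0 : EuclideanSpace ℝ (Fin d)), ContDiffAt ℝ ∞ φ x
  map_zero : φ 0 = P
  immersion : Function.Injective (fderiv ℝ φ 0)
  map_nhds : Filter.map φ (𝓝 0) = 𝓝[S] P

/-- `P` is a smooth point of `S`: near `P`, the set `S` is an embedded submanifold. -/
def IsSmoothPoint (S : Set E) (P : E) : Prop :=
  ∃ (d : ℕ) (φ : EuclideanSpace ℝ (Fin d) → E), IsLocalParam S P φ

/-- `P` is a critical point of `f` restricted to `S`: it is a smooth point of `S`, and the
differential of `f`, in every local parametrization of `S` around `P`, vanishes at `P`. -/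
def IsCriticalOn (f : E → ℝ) (S : Set E) (P : E) : Prop :=
  IsSmoothPoint S P ∧
    ∀ (d : ℕ) (φ : EuclideanSpace ℝ (Fin d) → E), IsLocalParam S P φ →
      HasFDerivAt (f ∘ φ) (0 : EuclideanSpace ℝ (Fin d) →L[ℝ] ℝ) 0

/-- The Hessian matrix `(∂²g / ∂xᵢ ∂xⱼ)(x)`. -/
noncomputable def hessian {d : ℕ} (g : EuclideanSpace ℝ (Fin d) → ℝ)
    (x : EuclideanSpace ℝ (Fin d)) : Matrix (Fin d) (Fin d) ℝ :=
  Matrix.of fun i j =>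
    fderiv ℝ (fderiv ℝ g) x (EuclideanSpace.single i 1) (EuclideanSpace.single j 1)

/-- The number of negative real eigenvalues of a square matrix, counted with their
multiplicities as roots of the characteristic polynomial. -/
noncomputable def numNegEigenvalues {d : ℕ} (A : Matrix (Fin d) (Fin d) ℝ) : ℕ :=
  (A.charpoly.roots.filter (fun t => t < 0)).card

/-- `P` is a critical point of `f` restricted to `S`, of Morse index `k`: the Hessian matrix of
`f` in any local parametrization of `S` around `P` has exactly `k` negative eigenvalues. -/
def HasMorseIndex (f : E → ℝ) (S : Set E) (P : E) (k : ℕ) : Prop :=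
  IsCriticalOn f S P ∧
    ∀ (d : ℕ) (φ : EuclideanSpace ℝ (Fin d) → E), IsLocalParam S P φ →
      numNegEigenvalues (hessian (f ∘ φ) 0) = k

end Manifold

/-- The determinantal variety of real `dy × dx` matrices of rank at most `r`. -/
def detVariety (dy dx r : ℕ) : Set (Matrix (Fin dy) (Fin dx) ℝ) :=
  {P | P.rank ≤ r}

/-- The squared Frobenius distance to `Q₀`. -/
noncomputable def sqDist {dy dx : ℕ} (Q₀ : Matrix (Fin dy) (Fin dx) ℝ) :
    Matrix (Fin dy) (Fin dx) ℝ → ℝ :=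
  fun P => ‖P - Q₀‖ ^ 2

/-- The `dy × dx` matrix with diagonal entries `σ` and all other entries `0`. -/
def rectDiag {dy dx : ℕ} (σ : Fin (min dy dx) → ℝ) : Matrix (Fin dy) (Fin dx) ℝ :=
  Matrix.of fun i j =>
    if h : i.val = j.val then σ ⟨i.val, lt_min i.isLt (h ▸ j.isLt)⟩ else 0

/-- The matrix `Σ_I`: the diagonal entries with index outside `I` are replaced by `0`. -/
def rectDiagOn {dy dx : ℕ} (σ : Fin (min dy dx) → ℝ) (I : Finset (Fin (min dy dx))) :
    Matrix (Fin dy) (Fin dx) ℝ :=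
  rectDiag fun i => if i ∈ I then σ i else 0

/-- `Q₀ = U Σ Vᵀ` is a singular value decomposition: `U`, `V` are orthogonal, and `Σ` is
diagonal with nonnegative decreasing entries `σ`. -/
structure IsSVD {dy dx : ℕ} (Q₀ : Matrix (Fin dy) (Fin dx) ℝ) (U : Matrix (Fin dy) (Fin dy) ℝ)
    (σ : Fin (min dy dx) → ℝ) (V : Matrix (Fin dx) (Fin dx) ℝ) : Prop where
  left_orthogonal : U ∈ Matrix.orthogonalGroup (Fin dy) ℝ
  right_orthogonal : V ∈ Matrix.orthogonalGroup (Fin dx) ℝ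
  antitone : Antitone σ
  nonneg : ∀ i, 0 ≤ σ i
  eq_mul : Q₀ = U * rectDiag σ * Vᵀ

/-- The index set of the `r` first (largest) singular values. -/
def firstIdx (m r : ℕ) : Finset (Fin m) :=
  Finset.univ.filter fun i => i.val < r

end EckartYoung

/-! Write `R = Q₀ - P` for the residual. The lines `P + t • (A * P)` and `P + t • (P * A)` never
leave the variety, so stationarity along them forces `Rᵀ * P = 0` and `P * Rᵀ = 0`. If `P` had rank
below `r`, every matrix unit would be an admissible direction too, and `Q₀ = P` would follow
(`rank_eq_and_orthogonal_of_stationary`). By orthogonality the singular vectors of `P` and `R`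
together form those of `Q₀`, so `P` is a truncated SVD (`exists_svd_of_orthogonal`).

Conversely, let `P` be a truncation, with generalized inverse `P'`. Near `P` the variety is the
image of the rational retraction `rankRetract`, which makes `P` a smooth point. The vanishing Schur
complement of a matrix `P + X` of rank at most `r` expresses `trace (Rᵀ * X)` by terms of order at
least two, so that along the variety the distance changes by `‖X‖² - 2 trace (Rᵀ X P' X) + o(‖X‖²)`
(`IsGInv.expansion`). There is no linear term, hence `P` is critical. The quadratic form, pulled
back by the derivative, is half the Hessian in every parametrization.

In the coordinates `Y = Uᵀ X V` this form splits into blocks `Y_ai² + Y_ia² - 2 (σ_a / σ_i) Y_ai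
Y_ia` with `i ∈ I`, `a ∉ I`, and squares. Such a block has eigenvalues `1 ± σ_a / σ_i`, thus a
negative one exactly when `σ_i < σ_a`. By Sylvester's law the Morse index is the number of these
inversions. A local minimum has none, so it keeps the largest singular values; these truncations are
global minima by a projection argument (`sum_compl_firstIdx_le`). -/

namespace EckartYoung

/-! ### First and second order calculus along a set, independent of the parametrization -/

section LocalParam

variable {E : Type*} [NormedAddCommGroup E] [NormedSpace ℝ E] {S : Set E} {P : E} {d : ℕ}
  {φ : EuclideanSpace ℝ (Fin d) → E}

open Asymptotics

namespace IsLocalParam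

theorem contDiffAt (h : IsLocalParam S P φ) : ContDiffAt ℝ ∞ φ 0 := h.smooth.self_of_nhds

theorem hasFDerivAt (h : IsLocalParam S P φ) : HasFDerivAt φ (fderiv ℝ φ 0) 0 :=
  (h.contDiffAt.differentiableAt (by simp)).hasFDerivAt

theorem isLittleO (h : IsLocalParam S P φ) :
    (fun x => φ x - P - fderiv ℝ φ 0 x) =o[𝓝 0] fun x => x := by
  simpa [h.map_zero] using h.hasFDerivAt.isLittleO

theorem mem (h : IsLocalParam S P φ) : P ∈ S := by
  have h1 : S ∈ Filter.map φ (𝓝 0) := h.map_nhds ▸ self_mem_nhdsWithin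
  have h2 : ∀ᶠ x in 𝓝 0, φ x ∈ S := h1
  simpa [h.map_zero] using h2.self_of_nhds

theorem isBigO (h : IsLocalParam S P φ) : (fun x => φ x - P) =O[𝓝 0] fun x => x := by
  simpa [h.map_zero] using h.hasFDerivAt.isBigO_sub

/-- An injective linear map on a finite-dimensional space is bounded below, and the remainder of `φ`
is negligible against it. Together with `isBigO` this makes `x` and `φ x - P` comparable, so
asymptotic estimates pass between the parameter space and `S`. -/
theorem isBigO_rev (h : IsLocalParam S P φ) : (fun x => x) =O[𝓝 0] fun x => φ x - P := by
  obtain ⟨K, -, hK⟩ := (fderiv ℝ φ 0).toLinearMap.exists_antilipschitzWith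
    (LinearMap.ker_eq_bot.2 h.immersion)
  have h1 : (fun x => x) =O[𝓝 0] fun x => fderiv ℝ φ 0 x := by
    refine IsBigO.of_bound K (Eventually.of_forall fun x => ?_)
    simpa using hK.le_mul_dist x 0
  have h2 : (fun x => fderiv ℝ φ 0 x) ~[𝓝 0] fun x => φ x - P :=
    IsEquivalent.symm (h.isLittleO.trans_isBigO h1)
  exact h1.trans h2.isBigO

end IsLocalParam

/-- At a smooth point, criticality is a first-order condition along the set itself. -/
theorem isCriticalOn_iff (f : E → ℝ) : IsCriticalOn f S P ↔
    IsSmoothPoint S P ∧ (fun Q => f Q - f P) =o[𝓝[S] P] fun Q => Q - P := by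
  have key : ∀ (d : ℕ) (φ : EuclideanSpace ℝ (Fin d) → E), IsLocalParam S P φ →
      (HasFDerivAt (f ∘ φ) (0 : EuclideanSpace ℝ (Fin d) →L[ℝ] ℝ) 0 ↔
        (fun Q => f Q - f P) =o[𝓝[S] P] fun Q => Q - P) := by
    intro d φ h
    have e : HasFDerivAt (f ∘ φ) (0 : EuclideanSpace ℝ (Fin d) →L[ℝ] ℝ) 0 ↔
        (fun x => f (φ x) - f P) =o[𝓝 0] fun x => x := by
      rw [hasFDerivAt_iff_isLittleO]; simp [h.map_zero]
    rw [e, ← h.map_nhds, isLittleO_map]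
    exact ⟨fun H => H.trans_isBigO h.isBigO_rev, fun H => H.trans_isBigO h.isBigO⟩
  constructor
  · rintro ⟨⟨d, φ, h⟩, H⟩
    exact ⟨⟨d, φ, h⟩, (key d φ h).1 (H d φ h)⟩
  · rintro ⟨hs, H⟩
    exact ⟨hs, fun d φ h => (key d φ h).2 H⟩

theorem tendsto_line {X : E} (hX : ∀ t : ℝ, P + t • X ∈ S) :
    Tendsto (fun t : ℝ => P + t • X) (𝓝 0) (𝓝[S] P) := by
  refine tendsto_nhdsWithin_iff.2 ⟨?_, Eventually.of_forall hX⟩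
  have : Continuous fun t : ℝ => P + t • X := by fun_prop
  simpa using this.tendsto 0

theorem IsCriticalOn.hasDerivAt_line {f : E → ℝ} (h : IsCriticalOn f S P) {X : E}
    (hX : ∀ t : ℝ, P + t • X ∈ S) : HasDerivAt (fun t : ℝ => f (P + t • X)) 0 0 := by
  have h1 := ((isCriticalOn_iff f).1 h).2.comp_tendsto (tendsto_line hX)
  rw [hasDerivAt_iff_isLittleO]
  have h2 : (fun t : ℝ => t • X) =O[𝓝 0] fun t : ℝ => t :=
    IsBigO.of_bound ‖X‖ (Eventually.of_forall fun t => by rw [norm_smul, mul_comm])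
  simp only [Function.comp_def, add_sub_cancel_left] at h1
  simpa using h1.trans_isBigO h2

theorem isLocalMinOn_hasDerivAt_line {f : E → ℝ} (h : IsLocalMinOn f S P) {X : E}
    (hX : ∀ t : ℝ, P + t • X ∈ S) {c : ℝ}
    (hc : HasDerivAt (fun t : ℝ => f (P + t • X)) c 0) : c = 0 := by
  refine IsLocalMin.hasDerivAt_eq_zero ?_ hc
  have := (tendsto_line hX).eventually h
  simpa [IsLocalMin, IsMinFilter] using this

/-- The direction of a line inside `S` through `P` is tangent to `S` at `P`. -/
theorem IsLocalParam.mem_range_fderiv [FiniteDimensional ℝ E] (h : IsLocalParam S P φ) {X : E}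
    (hX : ∀ t : ℝ, P + t • X ∈ S) : X ∈ (fderiv ℝ φ 0).range := by
  by_contra hn
  -- A functional that kills the range of the derivative is `o(Q - P)` along `S`. On the line inside
  -- `S` it is linear in `t`, so it must also kill `X`.
  obtain ⟨l, hl, hl0⟩ := Submodule.exists_dual_map_eq_bot_of_notMem hn inferInstance
  let L : E →L[ℝ] ℝ := LinearMap.toContinuousLinearMap l
  have hL : ∀ x, L (fderiv ℝ φ 0 x) = 0 := fun x => by
    have : l (fderiv ℝ φ 0 x) ∈ Submodule.map l (fderiv ℝ φ 0).range :=
      Submodule.mem_map_of_mem ⟨x, rfl⟩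
    rw [hl0] at this
    exact (Submodule.mem_bot ℝ).1 this
  have h1 : (fun x => L (φ x - P)) =o[𝓝 0] fun x => φ x - P := by
    have h2 := (L.isBigO_comp (fun x => φ x - P - fderiv ℝ φ 0 x) (𝓝 0)).trans_isLittleO
      h.isLittleO
    have h3 : (fun x => L (φ x - P - fderiv ℝ φ 0 x)) = fun x => L (φ x - P) := by
      funext x; rw [map_sub, hL, sub_zero]
    rw [h3] at h2
    exact h2.trans_isBigO h.isBigO_rev
  have h4 : (fun Q => L (Q - P)) =o[𝓝[S] P] fun Q => Q - P := by
    rw [← h.map_nhds, isLittleO_map]; exact h1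
  have h5 := h4.comp_tendsto (tendsto_line hX)
  simp only [Function.comp_def, add_sub_cancel_left] at h5
  have h6 : (fun t : ℝ => t • X) =O[𝓝 0] fun t : ℝ => t :=
    IsBigO.of_bound ‖X‖ (Eventually.of_forall fun t => by rw [norm_smul, mul_comm])
  have h7 : HasDerivAt (fun t : ℝ => L (t • X)) 0 0 := by
    rw [hasDerivAt_iff_isLittleO]; simpa using h5.trans_isBigO h6
  have h8 : HasDerivAt (fun t : ℝ => L (t • X)) (L X) 0 := by
    simpa using (hasDerivAt_id (0 : ℝ)).mul_const (L X)
  exact hl (h8.unique h7)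

/-- A second-order expansion along `S` pulls back to a local parametrization. -/
theorem IsLocalParam.expansion (h : IsLocalParam S P φ) {f : E → ℝ} {B : E →L[ℝ] E →L[ℝ] ℝ}
    (hf : (fun Q => f Q - f P - B (Q - P) (Q - P)) =o[𝓝[S] P] fun Q => ‖Q - P‖ ^ 2) :
    (fun x => f (φ x) - f P - B (fderiv ℝ φ 0 x) (fderiv ℝ φ 0 x)) =o[𝓝 0]
      fun x => ‖x‖ ^ 2 := by
  rw [← h.map_nhds, isLittleO_map] at hf
  have h1 : (fun x => ‖φ x - P‖ ^ 2) =O[𝓝 0] fun x => ‖x‖ ^ 2 := h.isBigO.norm_norm.pow 2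
  have h2 := hf.trans_isBigO h1
  simp only [Function.comp_def] at h2
  set D := fderiv ℝ φ 0 with hD
  have hDO : (fun x => D x) =O[𝓝 0] fun x => x := D.isBigO_id _
  have hBO : ∀ a b : EuclideanSpace ℝ (Fin d) → E,
      (fun x => B (a x) (b x)) =O[𝓝 0] fun x => ‖a x‖ * ‖b x‖ := fun a b =>
    IsBigO.of_bound ‖B‖ (Eventually.of_forall fun x => by
      simpa [mul_assoc] using B.le_opNorm₂ (a x) (b x))
  -- With `a = φ x - P` and `b = D x`: `B a a - B b b = B a (a - b) + B (a - b) b`, and `a - b` is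
  -- `o(x)`.
  have h3 : (fun x => B (φ x - P) (φ x - P - D x)) =o[𝓝 0] fun x => ‖x‖ ^ 2 := by
    refine (hBO _ _).trans_isLittleO ?_
    simp only [pow_two]
    exact h.isBigO.norm_norm.mul_isLittleO h.isLittleO.norm_norm
  have h4 : (fun x => B (φ x - P - D x) (D x)) =o[𝓝 0] fun x => ‖x‖ ^ 2 := by
    refine (hBO _ _).trans_isLittleO ?_
    simp only [pow_two]
    exact h.isLittleO.norm_norm.mul_isBigO hDO.norm_norm
  refine ((h2.add h3).add h4).congr_left fun x => ?_
  simp only [map_sub, _root_.sub_apply]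
  ring

/-- A `C²` function with a second-order expansion without linear part has the expected
second derivative. -/
theorem second_deriv_of_expansion {F : Type*} [NormedAddCommGroup F] [NormedSpace ℝ F]
    {g : F → ℝ} (hg : ContDiffAt ℝ 2 g 0) {B : F →L[ℝ] F →L[ℝ] ℝ}
    (hB : (fun x => g x - g 0 - B x x) =o[𝓝 0] fun x => ‖x‖ ^ 2) (v : F) :
    fderiv ℝ (fderiv ℝ g) 0 v v = 2 * B v v := by
  set c := fderiv ℝ (fderiv ℝ g) 0 v v with hc
  have hline : Tendsto (fun t : ℝ => t • v) (𝓝 0) (𝓝 0) := by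
    have : Continuous fun t : ℝ => t • v := by fun_prop
    simpa using this.tendsto 0
  have hd1 : ∀ᶠ x in 𝓝 (0 : F), DifferentiableAt ℝ g x := by
    filter_upwards [hg.eventually (by simp)] with x hx using hx.differentiableAt (by simp)
  have hd2 : DifferentiableAt ℝ (fderiv ℝ g) 0 :=
    (hg.fderiv_right (m := 1) (by norm_num)).differentiableAt (by simp)
  have hl : ∀ t : ℝ, HasDerivAt (fun t : ℝ => t • v) v t := fun t => by
    simpa using (hasDerivAt_id t).smul_const v
  have hu : ∀ᶠ t in 𝓝 (0 : ℝ), HasDerivAt (fun t : ℝ => g (t • v)) (fderiv ℝ g (t • v) v) t := by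
    filter_upwards [hline.eventually hd1] with t ht
    exact ht.hasFDerivAt.comp_hasDerivAt t (hl t)
  have hu2 : HasDerivAt (fun t : ℝ => fderiv ℝ g (t • v) v) c 0 := by
    have h0 : HasFDerivAt (fderiv ℝ g) (fderiv ℝ (fderiv ℝ g) 0) ((0 : ℝ) • v) := by
      simpa using hd2.hasFDerivAt
    have h1 : HasDerivAt (fun t : ℝ => fderiv ℝ g (t • v)) (fderiv ℝ (fderiv ℝ g) 0 v) 0 :=
      h0.comp_hasDerivAt 0 (hl 0)
    simpa using h1.clm_apply (hasDerivAt_const (0 : ℝ) v)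
  have hw : (fun t : ℝ => g (t • v) - g 0 - t ^ 2 * B v v) =o[𝓝 0] fun t : ℝ => t ^ 2 := by
    have h1 := hB.comp_tendsto hline
    have h2 : (fun t : ℝ => ‖t • v‖ ^ 2) =O[𝓝 0] fun t : ℝ => t ^ 2 := by
      refine IsBigO.of_bound (‖v‖ ^ 2) (Eventually.of_forall fun t => ?_)
      simp [norm_smul, mul_pow, mul_comm]
    refine (h1.trans_isBigO h2).congr_left fun t => ?_
    simp; ring
  have hw0 : fderiv ℝ g 0 v = 0 := by
    have h1 : HasDerivAt (fun t : ℝ => g (t • v) - g 0 - t ^ 2 * B v v) (fderiv ℝ g 0 v) 0 := by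
      have h2 := (hu.self_of_nhds.sub_const (g 0)).sub
        (((hasDerivAt_id (0 : ℝ)).pow 2).mul_const (B v v))
      refine h2.congr_deriv ?_
      simp
    have h2 : HasDerivAt (fun t : ℝ => g (t • v) - g 0 - t ^ 2 * B v v) 0 0 := by
      rw [hasDerivAt_iff_isLittleO]
      have : (fun t : ℝ => t ^ 2) =O[𝓝 0] fun t : ℝ => t :=
        (isLittleO_pow_id (by norm_num)).isBigO
      simpa using hw.trans_isBigO this
    exact h1.unique h2
  obtain ⟨ε, hε, hball⟩ := Metric.eventually_nhds_iff_ball.1 hu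
  -- Integrating the first-order expansion of the derivative along the line gives Taylor's formula
  -- with coefficient `c / 2`. Comparison with `hw` then identifies `c / 2` and `B v v`.
  have hrem : (fun t : ℝ => g (t • v) - g 0 - c / 2 * t ^ 2) =o[𝓝 0] fun t : ℝ => t ^ 2 := by
    have hcx := Convex.isLittleO_pow_succ_real (n := 1) (x₀ := (0 : ℝ))
      (f := fun t : ℝ => g (t • v) - c / 2 * t ^ 2)
      (f' := fun t : ℝ => fderiv ℝ g (t • v) v - c * t)
      (convex_ball (0 : ℝ) ε) (Metric.mem_ball_self hε) (fun t ht => by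
        have h2 := (hball t ht).sub (((hasDerivAt_id t).pow 2).const_mul (c / 2))
        refine (h2.congr_deriv ?_).hasDerivWithinAt
        simp; ring) (by
        rw [nhdsWithin_eq_nhds.2 (Metric.ball_mem_nhds _ hε)]
        have := hasDerivAt_iff_isLittleO.1 hu2
        simp only [sub_zero, zero_smul, hw0, smul_eq_mul] at this
        simpa [mul_comm] using this)
    rw [nhdsWithin_eq_nhds.2 (Metric.ball_mem_nhds _ hε)] at hcx
    refine (hcx.congr_right fun t => by simp).congr_left fun t => ?_
    simp; ring
  have hfin : (fun t : ℝ => (c / 2 - B v v) * t ^ 2) =o[𝓝 0] fun t : ℝ => t ^ 2 :=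
    (hw.sub hrem).congr_left fun t => by ring
  by_contra hne
  have hne' : c / 2 - B v v ≠ 0 := fun h0 => hne (by linarith)
  have h1 : (fun t : ℝ => t ^ 2) =o[𝓝 0] fun t : ℝ => t ^ 2 :=
    (isLittleO_const_mul_left_iff hne').1 hfin
  have h2 := h1.def (c := 1 / 2) (by norm_num)
  obtain ⟨δ, hδ, hb⟩ := Metric.eventually_nhds_iff_ball.1 h2
  have h3 := hb (δ / 2) (by simp [abs_of_pos hδ]; linarith)
  have : 0 < ‖(δ / 2) ^ 2‖ := norm_pos_iff.2 (by positivity)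
  linarith

end LocalParam

/-! ### Sylvester's law of inertia -/

section Inertia

theorem numNegEigenvalues_eq_card {d : ℕ} {A : Matrix (Fin d) (Fin d) ℝ} (hA : A.IsHermitian) :
    numNegEigenvalues A = Fintype.card {i // hA.eigenvalues i < 0} := by
  rw [numNegEigenvalues, hA.roots_charpoly_eq_eigenvalues, Multiset.filter_map, Multiset.card_map,
    Fintype.card_subtype]
  rfl

theorem exists_diagonalization {d : ℕ} {A : Matrix (Fin d) (Fin d) ℝ} (hA : A.IsHermitian) :
    ∃ U : Matrix (Fin d) (Fin d) ℝ, Uᵀ * U = 1 ∧ U * Uᵀ = 1 ∧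
      ∀ y, (U *ᵥ y) ⬝ᵥ A *ᵥ (U *ᵥ y) = ∑ i, hA.eigenvalues i * y i ^ 2 := by
  let U : Matrix (Fin d) (Fin d) ℝ := (hA.eigenvectorUnitary).1
  have hs : star U = Uᵀ := by rw [star_eq_conjTranspose, conjTranspose_eq_transpose_of_trivial]
  have h1 : Uᵀ * U = 1 := by rw [← hs]; exact Unitary.coe_star_mul_self hA.eigenvectorUnitary
  have h2 : U * Uᵀ = 1 := by rw [← hs]; exact Unitary.coe_mul_star_self hA.eigenvectorUnitary
  refine ⟨U, h1, h2, fun y => ?_⟩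
  have h3 : A = U * diagonal hA.eigenvalues * Uᵀ := by
    have := hA.spectral_theorem
    rw [Unitary.conjStarAlgAut_apply] at this
    rw [← hs]
    exact this
  have h4 : Uᵀ * A * U = diagonal hA.eigenvalues := by
    nth_rewrite 1 [h3]
    calc Uᵀ * (U * diagonal hA.eigenvalues * Uᵀ) * U
        = (Uᵀ * U) * diagonal hA.eigenvalues * (Uᵀ * U) := by simp only [Matrix.mul_assoc]
      _ = _ := by rw [h1, Matrix.one_mul, Matrix.mul_one]
  calc (U *ᵥ y) ⬝ᵥ A *ᵥ (U *ᵥ y) = y ⬝ᵥ (Uᵀ * A * U) *ᵥ y := by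
        rw [dotProduct_comm, dotProduct_mulVec, ← mulVec_transpose, dotProduct_comm, mulVec_mulVec,
          mulVec_mulVec]
    _ = _ := by
        rw [h4]
        simp only [dotProduct, mulVec_diagonal]
        exact Finset.sum_congr rfl fun i _ => by ring

/-- Sylvester's law of inertia, in the form of a criterion: a symmetric form that is negative
definite on a `k`-dimensional space and nonnegative on the common kernel of `k` linear
functionals has exactly `k` negative eigenvalues. -/
theorem numNegEigenvalues_eq_of_forms {d : ℕ} {A : Matrix (Fin d) (Fin d) ℝ} (hA : A.IsHermitian)
    {ι : Type*} [Fintype ι] (W : (ι → ℝ) →ₗ[ℝ] (Fin d → ℝ)) (Λ : (Fin d → ℝ) →ₗ[ℝ] (ι → ℝ))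
    (hW : ∀ c, c ≠ 0 → W c ⬝ᵥ A *ᵥ W c < 0) (hΛ : ∀ v, Λ v = 0 → 0 ≤ v ⬝ᵥ A *ᵥ v) :
    numNegEigenvalues A = Fintype.card ι := by
  classical
  rw [numNegEigenvalues_eq_card hA]
  obtain ⟨U, h1, h2, hU⟩ := exists_diagonalization hA
  apply le_antisymm
  -- On the negative eigenspaces `Λ` is injective: a vector in its kernel has a form value that is
  -- both nonnegative and a sum of nonpositive terms. Hence at most `card ι` negative eigenvalues.
  · let Z : ({i // hA.eigenvalues i < 0} → ℝ) →ₗ[ℝ] (Fin d → ℝ) :=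
      Function.ExtendByZero.linearMap ℝ Subtype.val
    have hZ : ∀ c (i : {i // hA.eigenvalues i < 0}), Z c i = c i := fun c i =>
      Function.Injective.extend_apply Subtype.val_injective c (0 : Fin d → ℝ) i
    have hZ' : ∀ c (i : Fin d), ¬ hA.eigenvalues i < 0 → Z c i = 0 := fun c i hi =>
      
      Function.extend_apply' c (0 : Fin d → ℝ) i (by rintro ⟨a, rfl⟩; exact hi a.2)
    have hinj : Function.Injective (Λ ∘ₗ U.mulVecLin ∘ₗ Z) := by
      rw [injective_iff_map_eq_zero]
      intro c hc
      have h3 := hΛ _ hc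
      simp only [LinearMap.comp_apply, mulVecLin_apply] at h3
      rw [hU] at h3
      have h4 : ∀ i ∈ Finset.univ, hA.eigenvalues i * Z c i ^ 2 ≤ 0 := fun i _ => by
        by_cases hi : hA.eigenvalues i < 0
        · exact mul_nonpos_of_nonpos_of_nonneg hi.le (sq_nonneg _)
        · simp [hZ' c i hi]
      have h5 := (Finset.sum_eq_zero_iff_of_nonpos h4).1
        (le_antisymm (Finset.sum_nonpos h4) h3)
      funext i
      have h6 := h5 i (Finset.mem_univ _)
      rw [hZ] at h6
      simpa [i.2.ne] using h6
    simpa using LinearMap.finrank_le_finrank_of_injective hinj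
  -- Dually, a vector `W c` without negative eigencoordinates has nonnegative form value, so
  -- projection to these coordinates is injective on the image of `W`.
  · let Z : (Fin d → ℝ) →ₗ[ℝ] ({i // hA.eigenvalues i < 0} → ℝ) :=
      LinearMap.funLeft ℝ ℝ Subtype.val
    have hinj : Function.Injective (Z ∘ₗ (Uᵀ).mulVecLin ∘ₗ W) := by
      rw [injective_iff_map_eq_zero]
      intro c hc
      by_contra hne
      have h3 := hW c hne
      have h4 : W c = U *ᵥ (Uᵀ *ᵥ W c) := by rw [mulVec_mulVec, h2, one_mulVec]
      rw [h4, hU] at h3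
      refine absurd h3 (not_lt.2 (Finset.sum_nonneg fun i _ => ?_))
      by_cases hi : hA.eigenvalues i < 0
      · have : (Uᵀ *ᵥ W c) i = 0 := congrFun hc ⟨i, hi⟩
        simp [this]
      · exact mul_nonneg (not_lt.1 hi) (sq_nonneg _)
    simpa using LinearMap.finrank_le_finrank_of_injective hinj

end Inertia

/-! ### The Hessian matrix as a quadratic form -/

section Hessian

variable {d : ℕ} {g : EuclideanSpace ℝ (Fin d) → ℝ} {x : EuclideanSpace ℝ (Fin d)}

theorem hessian_isHermitian (hg : ContDiffAt ℝ 2 g x) : (hessian g x).IsHermitian := by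
  have hs : IsSymmSndFDerivAt ℝ g x := hg.isSymmSndFDerivAt (by simp)
  ext i j
  simp only [conjTranspose_apply, hessian, of_apply, star_trivial]
  exact hs _ _

theorem dotProduct_hessian_mulVec (v : EuclideanSpace ℝ (Fin d)) :
    v.ofLp ⬝ᵥ hessian g x *ᵥ v.ofLp = fderiv ℝ (fderiv ℝ g) x v v := by
  have hv : v = ∑ i, v i • EuclideanSpace.single i (1 : ℝ) := by
    ext j; simp [Finset.sum_apply, Pi.single_apply]
  conv_rhs => rw [hv]
  simp only [map_sum, map_smul, _root_.sum_apply, _root_.smul_apply, dotProduct, mulVec, hessian,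
    of_apply, smul_eq_mul, Finset.mul_sum]
  rw [Finset.sum_comm]
  exact Finset.sum_congr rfl fun i _ => Finset.sum_congr rfl fun j _ => by ring

end Hessian

/-! ### Morse index and second-order condition from an expansion along the set -/

section MorseIndex

variable {E : Type*} [NormedAddCommGroup E] [NormedSpace ℝ E] {S : Set E} {P : E}

open Asymptotics

/-- The expansion of `f` is required only along `S`, so the curvature of `S` is already contained in
`B`, and no second derivative of `φ` appears. -/
theorem IsLocalParam.fderiv_fderiv_comp {d : ℕ} {φ : EuclideanSpace ℝ (Fin d) → E}
    (h : IsLocalParam S P φ) {f : E → ℝ} (hfs : ContDiffAt ℝ 2 f P) {B : E →L[ℝ] E →L[ℝ] ℝ}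
    (hf : (fun Q => f Q - f P - B (Q - P) (Q - P)) =o[𝓝[S] P] fun Q => ‖Q - P‖ ^ 2)
    (v : EuclideanSpace ℝ (Fin d)) :
    fderiv ℝ (fderiv ℝ (f ∘ φ)) 0 v v = 2 * B (fderiv ℝ φ 0 v) (fderiv ℝ φ 0 v) := by
  have hg : ContDiffAt ℝ 2 (f ∘ φ) 0 :=
    ContDiffAt.comp 0 (by rwa [h.map_zero]) (contDiffAt_infty.1 h.contDiffAt 2)
  have := second_deriv_of_expansion hg (B := B.bilinearComp (fderiv ℝ φ 0) (fderiv ℝ φ 0))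
    (by simpa [h.map_zero] using h.expansion hf) v
  simpa using this

/-- A second-order expansion without linear term makes a smooth point critical. -/
theorem isCriticalOn_of_expansion {f : E → ℝ} (hS : IsSmoothPoint S P) {B : E →L[ℝ] E →L[ℝ] ℝ}
    (hf : (fun Q => f Q - f P - B (Q - P) (Q - P)) =o[𝓝[S] P] fun Q => ‖Q - P‖ ^ 2) :
    IsCriticalOn f S P := by
  refine (isCriticalOn_iff _).2 ⟨hS, ?_⟩
  have h1 : (fun Q => B (Q - P) (Q - P)) =O[𝓝[S] P] fun Q => ‖Q - P‖ ^ 2 :=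
    IsBigO.of_bound ‖B‖ (Eventually.of_forall fun Q => by
      simpa [pow_two, mul_assoc] using B.le_opNorm₂ (Q - P) (Q - P))
  have h2 : (fun Q => f Q - f P) =O[𝓝[S] P] fun Q => ‖Q - P‖ ^ 2 :=
    (hf.isBigO.add h1).congr_left fun Q => by ring
  refine h2.trans_isLittleO ?_
  have h3 : Tendsto (fun Q : E => ‖Q - P‖) (𝓝[S] P) (𝓝 0) := by
    have : Continuous fun Q : E => ‖Q - P‖ := by fun_prop
    have := this.tendsto P
    rw [sub_self, norm_zero] at this
    exact this.mono_left nhdsWithin_le_nhds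
  have h4 := ((isLittleO_one_iff ℝ).2 h3).mul_isBigO
    (isBigO_refl (fun Q : E => ‖Q - P‖) (𝓝[S] P))
  exact (h4.congr (fun Q => (pow_two _).symm) fun Q => one_mul _).trans_isBigO
    (isBigO_refl _ _).norm_left

/-- The Morse index, read off from a second-order expansion of `f` along `S`: negative definite
on the span of `ι`-many directions of sums of lines in `S`, nonnegative on the common kernel
of `ι`-many functionals. -/
theorem hasMorseIndex_of_expansion [FiniteDimensional ℝ E] {f : E → ℝ} (hfs : ContDiffAt ℝ 2 f P)
    (hcrit : IsCriticalOn f S P) {B : E →L[ℝ] E →L[ℝ] ℝ}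
    (hf : (fun Q => f Q - f P - B (Q - P) (Q - P)) =o[𝓝[S] P] fun Q => ‖Q - P‖ ^ 2)
    {ι : Type*} [Fintype ι] (W : (ι → ℝ) →ₗ[ℝ] E) (Λ : E →ₗ[ℝ] (ι → ℝ))
    (hWS : ∀ c, W c ∈ Submodule.span ℝ {X : E | ∀ t : ℝ, P + t • X ∈ S})
    (hW : ∀ c, c ≠ 0 → B (W c) (W c) < 0) (hΛ : ∀ X, Λ X = 0 → 0 ≤ B X X) :
    HasMorseIndex f S P (Fintype.card ι) := by
  refine ⟨hcrit, fun d φ h => ?_⟩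
  have hg : ContDiffAt ℝ 2 (f ∘ φ) 0 :=
    ContDiffAt.comp 0 (by rwa [h.map_zero]) (contDiffAt_infty.1 h.contDiffAt 2)
  have hform : ∀ v : Fin d → ℝ, v ⬝ᵥ hessian (f ∘ φ) 0 *ᵥ v =
      2 * B (fderiv ℝ φ 0 (WithLp.toLp 2 v)) (fderiv ℝ φ 0 (WithLp.toLp 2 v)) := fun v => by
    rw [← h.fderiv_fderiv_comp hfs hf, ← dotProduct_hessian_mulVec]
  set D := fderiv ℝ φ 0 with hD
  -- Directions of lines in `S` are tangent, so `W` takes values in the range of the injective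
  -- derivative and can be pulled back to the parameter space.
  have hrange : ∀ c, W c ∈ D.range := fun c => by
    refine Submodule.span_le.2 ?_ (hWS c)
    intro X hX
    exact h.mem_range_fderiv hX
  let e := LinearEquiv.ofInjective (D : EuclideanSpace ℝ (Fin d) →ₗ[ℝ] E) h.immersion
  let W' : (ι → ℝ) →ₗ[ℝ] (Fin d → ℝ) :=
    (WithLp.linearEquiv 2 ℝ (Fin d → ℝ)).toLinearMap ∘ₗ e.symm.toLinearMap ∘ₗ
      W.codRestrict _ hrange
  have hW' : ∀ c, D (WithLp.toLp 2 (W' c)) = W c := fun c => by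
    have := LinearEquiv.apply_symm_apply e (W.codRestrict _ hrange c)
    exact congrArg Subtype.val this
  refine numNegEigenvalues_eq_of_forms (hessian_isHermitian hg) W'
    (Λ ∘ₗ (D : EuclideanSpace ℝ (Fin d) →ₗ[ℝ] E) ∘ₗ
      (WithLp.linearEquiv 2 ℝ (Fin d → ℝ)).symm.toLinearMap) (fun c hc => ?_) (fun v hv => ?_)
  · rw [hform, hW']; linarith [hW c hc]
  · rw [hform]
    exact mul_nonneg zero_le_two (hΛ (D (WithLp.toLp 2 v)) hv)

/-- The second-order necessary condition at a local minimum. -/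
theorem nonneg_of_isLocalMinOn [FiniteDimensional ℝ E] {f : E → ℝ}
    (hS : IsSmoothPoint S P) (hmin : IsLocalMinOn f S P) {B : E →L[ℝ] E →L[ℝ] ℝ}
    (hf : (fun Q => f Q - f P - B (Q - P) (Q - P)) =o[𝓝[S] P] fun Q => ‖Q - P‖ ^ 2)
    {X : E} (hX : X ∈ Submodule.span ℝ {X : E | ∀ t : ℝ, P + t • X ∈ S}) : 0 ≤ B X X := by
  obtain ⟨d, φ, h⟩ := hS
  have hle : Submodule.span ℝ {X : E | ∀ t : ℝ, P + t • X ∈ S} ≤ (fderiv ℝ φ 0).range :=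
    Submodule.span_le.2 fun X hX => h.mem_range_fderiv hX
  obtain ⟨v, rfl⟩ := hle hX
  by_contra hneg
  push Not at hneg
  set b := B (fderiv ℝ φ 0 v) (fderiv ℝ φ 0 v) with hb
  have hline : Tendsto (fun t : ℝ => t • v) (𝓝 0) (𝓝 0) := by
    have : Continuous fun t : ℝ => t • v := by fun_prop
    simpa using this.tendsto 0
  have h1 := (h.expansion hf).comp_tendsto hline
  have h2 : (fun t : ℝ => ‖t • v‖ ^ 2) =O[𝓝 0] fun t : ℝ => t ^ 2 := by
    refine IsBigO.of_bound (‖v‖ ^ 2) (Eventually.of_forall fun t => ?_)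
    simp [norm_smul, mul_pow, mul_comm]
  have h3 : ∀ᶠ x in 𝓝 0, f P ≤ f (φ x) := by
    have : ∀ᶠ Q in 𝓝[S] P, f P ≤ f Q := hmin
    rw [← h.map_nhds] at this
    exact this
  -- With error at most `(-b / 2) t²`, the value of `f` along `t • v` lies at least `(-b / 2) t²`
  -- below `f P`, against minimality.
  have h4 := (h1.trans_isBigO h2).def (c := -b / 2) (by
    change b < 0 at hneg
    linarith)
  obtain ⟨δ, hδ, hball⟩ := Metric.eventually_nhds_iff_ball.1 (h4.and (hline.eventually h3))
  obtain ⟨h5, h6⟩ := hball (δ / 2) (by simp [abs_of_pos hδ]; linarith)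
  simp only [Function.comp_apply, map_smul, _root_.smul_apply, smul_eq_mul] at h5
  rw [← hb, Real.norm_eq_abs, Real.norm_of_nonneg (by positivity : (0:ℝ) ≤ (δ / 2) ^ 2)] at h5
  have h7 := le_of_abs_le h5
  have h8 : 0 < (δ / 2) ^ 2 := by positivity
  change b < 0 at hneg
  nlinarith

end MorseIndex

/-! ### Frobenius norm, traces and smoothness of matrix operations -/

section MatrixNorm

variable {l m n E : Type*} [Fintype l] [Fintype m] [Fintype n]

theorem norm_sq_eq_trace (A : Matrix m n ℝ) : ‖A‖ ^ 2 = trace (Aᵀ * A) := by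
  rw [frobenius_norm_def, ← Real.sqrt_eq_rpow, Real.sq_sqrt (by positivity), trace]
  simp only [diag_apply, mul_apply, transpose_apply]
  rw [Finset.sum_comm]
  simp [pow_two]

theorem norm_sq_eq_sum (A : Matrix m n ℝ) : ‖A‖ ^ 2 = ∑ i, ∑ j, A i j ^ 2 := by
  rw [frobenius_norm_def, ← Real.sqrt_eq_rpow, Real.sq_sqrt (by positivity)]
  simp

theorem trace_transpose_mul_comm (A B : Matrix m n ℝ) : trace (Aᵀ * B) = trace (Bᵀ * A) := by
  rw [← trace_transpose, transpose_mul, transpose_transpose]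

theorem norm_sub_sq_eq (A B : Matrix m n ℝ) :
    ‖A - B‖ ^ 2 = ‖A‖ ^ 2 - 2 * trace (Bᵀ * A) + ‖B‖ ^ 2 := by
  simp only [norm_sq_eq_trace, transpose_sub, Matrix.sub_mul, Matrix.mul_sub, trace_sub]
  rw [trace_transpose_mul_comm A B]
  ring

theorem isBoundedBilinearMap_matrix_mul :
    IsBoundedBilinearMap ℝ fun p : Matrix l m ℝ × Matrix m n ℝ => p.1 * p.2 where
  add_left := Matrix.add_mul
  smul_left c x y := Matrix.smul_mul c x y
  add_right := Matrix.mul_add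
  smul_right c x y := Matrix.mul_smul x c y
  bound := ⟨1, one_pos, fun x y => by simpa using frobenius_norm_mul x y⟩

variable [NormedAddCommGroup E] [NormedSpace ℝ E]

theorem contDiffAt_matrix_mul {f : E → Matrix l m ℝ} {g : E → Matrix m n ℝ} {x : E} {k : ℕ∞ω}
    (hf : ContDiffAt ℝ k f x) (hg : ContDiffAt ℝ k g x) :
    ContDiffAt ℝ k (fun y => f y * g y) x :=
  (isBoundedBilinearMap_matrix_mul (l := l) (m := m) (n := n)).contDiff.contDiffAt.comp x
    (hf.prodMk hg)

theorem contDiffAt_matrix_inv [DecidableEq n] {A : Matrix n n ℝ} (hA : IsUnit A.det) {k : ℕ∞ω} :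
    ContDiffAt ℝ k (fun B : Matrix n n ℝ => B⁻¹) A := by
  have : CompleteSpace (Matrix n n ℝ) := FiniteDimensional.complete ℝ _
  obtain ⟨u, rfl⟩ := (isUnit_iff_isUnit_det A).2 hA
  have := contDiffAt_ringInverse ℝ (n := k) u
  refine this.congr_of_eventuallyEq (Eventually.of_forall fun B => ?_)
  exact nonsing_inv_eq_ringInverse B

end MatrixNorm

/-! ### The matrices of rank at most `r` near a matrix of rank `r` -/

section GeneralizedInverse

variable {dy dx : ℕ}

/-- `P'` is a reflexive generalized inverse of `P`. -/
structure IsGInv (P : Matrix (Fin dy) (Fin dx) ℝ) (P' : Matrix (Fin dx) (Fin dy) ℝ) : Prop where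
  mul_mul : P * P' * P = P
  mul_mul' : P' * P * P' = P'

/-- The retraction of a neighbourhood of `P` onto the matrices of rank at most `P.rank`,
centred at `P`. -/
noncomputable def rankRetract (P : Matrix (Fin dy) (Fin dx) ℝ) (P' : Matrix (Fin dx) (Fin dy) ℝ) (X : Matrix (Fin dy) (Fin dx) ℝ) :
    Matrix (Fin dy) (Fin dx) ℝ :=
  (P + X) * (1 - (1 + P' * X)⁻¹ * (1 - P' * P))

/-- The projection onto the tangent space at `P` of the matrices of rank `P.rank`. -/
def tangentProj (P : Matrix (Fin dy) (Fin dx) ℝ) (P' : Matrix (Fin dx) (Fin dy) ℝ) : Matrix (Fin dy) (Fin dx) ℝ →ₗ[ℝ] Matrix (Fin dy) (Fin dx) ℝ where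
  toFun X := X - (1 - P * P') * X * (1 - P' * P)
  map_add' X Y := by rw [Matrix.mul_add, Matrix.add_mul]; abel
  map_smul' c X := by simp [smul_sub]

theorem tangentProj_apply (P : Matrix (Fin dy) (Fin dx) ℝ) (P' : Matrix (Fin dx) (Fin dy) ℝ) (X : Matrix (Fin dy) (Fin dx) ℝ) :
    tangentProj P P' X = X - (1 - P * P') * X * (1 - P' * P) := rfl

variable {P : Matrix (Fin dy) (Fin dx) ℝ} {P' : Matrix (Fin dx) (Fin dy) ℝ} {X : Matrix (Fin dy) (Fin dx) ℝ}

namespace IsGInv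

theorem rank_le (h : IsGInv P P') : P'.rank ≤ P.rank := by
  rw [← h.mul_mul']
  exact (rank_mul_le_left _ _).trans (rank_mul_le_right _ _)

theorem mul_one_sub (h : IsGInv P P') : P * (1 - P' * P) = 0 := by
  rw [Matrix.mul_sub, ← Matrix.mul_assoc, h.mul_mul, Matrix.mul_one, sub_self]

theorem mul_one_sub' (h : IsGInv P P') : P' * (1 - P * P') = 0 := by
  rw [Matrix.mul_sub, ← Matrix.mul_assoc, h.mul_mul', Matrix.mul_one, sub_self]

theorem one_sub_mul' (h : IsGInv P P') : (1 - P' * P) * P' = 0 := by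
  rw [Matrix.sub_mul, h.mul_mul', Matrix.one_mul, sub_self]

theorem one_sub_sq (h : IsGInv P P') : (1 - P' * P) * (1 - P' * P) = 1 - P' * P := by
  rw [Matrix.sub_mul, Matrix.mul_assoc, h.mul_one_sub, Matrix.mul_zero, sub_zero, Matrix.one_mul]

theorem one_sub_sq' (h : IsGInv P P') : (1 - P * P') * (1 - P * P') = 1 - P * P' := by
  rw [Matrix.sub_mul, Matrix.mul_assoc, h.mul_one_sub', Matrix.mul_zero, sub_zero, Matrix.one_mul]

theorem tangentProj_tangentProj (h : IsGInv P P') (X : Matrix (Fin dy) (Fin dx) ℝ) :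
    tangentProj P P' (tangentProj P P' X) = tangentProj P P' X := by
  have h1 : (1 - P * P') * ((1 - P * P') * X * (1 - P' * P)) * (1 - P' * P) =
      (1 - P * P') * X * (1 - P' * P) := by
    calc _ = ((1 - P * P') * (1 - P * P')) * X * ((1 - P' * P) * (1 - P' * P)) := by
          simp only [Matrix.mul_assoc]
      _ = _ := by rw [h.one_sub_sq, h.one_sub_sq']
  rw [tangentProj_apply, tangentProj_apply, Matrix.mul_sub (1 - P * P') X,
    Matrix.sub_mul _ _ (1 - P' * P), h1, sub_self, sub_zero]

theorem eventually_isUnit (P' : Matrix (Fin dx) (Fin dy) ℝ) :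
    ∀ᶠ X : Matrix (Fin dy) (Fin dx) ℝ in 𝓝 0, IsUnit (1 + P' * X).det := by
  have hc : Continuous fun X : Matrix (Fin dy) (Fin dx) ℝ => (1 + P' * X).det := by fun_prop
  have : ∀ᶠ X : Matrix (Fin dy) (Fin dx) ℝ in 𝓝 0, (1 + P' * X).det ≠ 0 :=
    hc.continuousAt.eventually_ne (by simp)
  filter_upwards [this] with X hX using isUnit_iff_ne_zero.2 hX

/-- From `P * P' * P = P` one gets `P * P' * (P + X) = P * (1 + P' * X)`. This is block elimination:
the component of `(P + X) * (1 + P' * X)⁻¹` in the range of `P` is `P` itself. -/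
theorem mul_schur (h : IsGInv P P') (hX : IsUnit (1 + P' * X).det) :
    P * P' * ((P + X) * (1 + P' * X)⁻¹) = P := by
  have : P * P' * (P + X) = P * (1 + P' * X) := by
    rw [Matrix.mul_add, h.mul_mul, Matrix.mul_add, Matrix.mul_one, Matrix.mul_assoc]
  rw [← Matrix.mul_assoc, this, mul_nonsing_inv_cancel_right _ _ hX]

/-- The Schur complement of a matrix of rank at most `P.rank` near `P` vanishes. -/
theorem schur_eq_zero (h : IsGInv P P') (hX : IsUnit (1 + P' * X).det)
    (hr : (P + X).rank ≤ P.rank) : (P + X) * (1 + P' * X)⁻¹ * (1 - P' * P) = 0 := by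
  set Y := (P + X) * (1 + P' * X)⁻¹ with hY
  have hPY : P * P' * Y = P := h.mul_schur hX
  have hYr : Y.rank ≤ P.rank := (rank_mul_le_left _ _).trans hr
  -- By `mul_schur` the kernel of `Y` is contained in that of `P`; the rank bound makes them equal,
  -- and `1 - P' * P` maps into the latter.
  have hker : LinearMap.ker Y.mulVecLin ≤ LinearMap.ker P.mulVecLin := by
    intro v hv
    rw [LinearMap.mem_ker, mulVecLin_apply] at hv ⊢
    rw [← hPY, ← mulVec_mulVec, hv, mulVec_zero]
  have heq : LinearMap.ker Y.mulVecLin = LinearMap.ker P.mulVecLin := by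
    refine Submodule.eq_of_le_of_finrank_le hker ?_
    have h1 := Y.mulVecLin.finrank_range_add_finrank_ker
    have h2 := P.mulVecLin.finrank_range_add_finrank_ker
    simp only [Matrix.rank] at hYr
    omega
  refine (Matrix.ext_iff_mulVec).2 fun v => ?_
  have hv : (1 - P' * P) *ᵥ v ∈ LinearMap.ker P.mulVecLin := by
    rw [LinearMap.mem_ker, mulVecLin_apply, mulVec_mulVec, h.mul_one_sub, zero_mulVec]
  rw [← heq, LinearMap.mem_ker, mulVecLin_apply, mulVec_mulVec] at hv
  rw [hv, zero_mulVec]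

theorem rankRetract_eq (h : IsGInv P P') (hX : IsUnit (1 + P' * X).det)
    (hr : (P + X).rank ≤ P.rank) : rankRetract P P' X = P + X := by
  rw [rankRetract, Matrix.mul_sub, ← Matrix.mul_assoc, h.schur_eq_zero hX hr, sub_zero,
    Matrix.mul_one]

/-- The second factor of `rankRetract` equals `(1 + P' * X)⁻¹ * (P' * (P + X))`, so the product
factors through `P'`. -/
theorem rank_rankRetract_le (h : IsGInv P P') (hX : IsUnit (1 + P' * X).det) :
    (rankRetract P P' X).rank ≤ P.rank := by
  have h1 : 1 - (1 + P' * X)⁻¹ * (1 - P' * P) = (1 + P' * X)⁻¹ * (P' * (P + X)) := by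
    have : P' * (P + X) = (1 + P' * X) - (1 - P' * P) := by rw [Matrix.mul_add]; abel
    rw [this, Matrix.mul_sub _ (1 + P' * X), nonsing_inv_mul _ hX]
  rw [rankRetract, h1]
  exact (rank_mul_le_right _ _).trans ((rank_mul_le_right _ _).trans
    ((rank_mul_le_left _ _).trans h.rank_le))

/-- The correction `Z` subtracted by the retraction satisfies `P * P' * Z = 0` and `Z * (1 - P' * P)
= Z`, so it is purely normal. This yields the immersion property. -/
theorem tangentProj_rankRetract (h : IsGInv P P') (hX : IsUnit (1 + P' * X).det) :
    tangentProj P P' (rankRetract P P' X - P) = tangentProj P P' X := by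
  set Z := (P + X) * (1 + P' * X)⁻¹ * (1 - P' * P) with hZ
  have h1 : rankRetract P P' X - P = X - Z := by
    rw [rankRetract, Matrix.mul_sub, ← Matrix.mul_assoc, Matrix.mul_one]; abel
  have h2 : Z * (1 - P' * P) = Z := by rw [hZ, Matrix.mul_assoc, h.one_sub_sq]
  have h3 : P * P' * Z = 0 := by
    rw [hZ, ← Matrix.mul_assoc, h.mul_schur hX, h.mul_one_sub]
  have h4 : tangentProj P P' Z = 0 := by
    rw [tangentProj_apply, Matrix.mul_assoc, h2, Matrix.sub_mul, h3, Matrix.one_mul, sub_zero,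
      sub_self]
  rw [h1, map_sub, h4, sub_zero]

/-- The normal part `(1 - P * P') * X * (1 - P' * P)` is killed by `P'` on the left and by the
second factor of the retraction on the right. So nearby points of the variety are recovered from
their tangential coordinates. -/
theorem rankRetract_tangentProj (h : IsGInv P P') (hX : IsUnit (1 + P' * X).det) :
    rankRetract P P' (tangentProj P P' X) = rankRetract P P' X := by
  have h1 : P' * tangentProj P P' X = P' * X := by
    rw [tangentProj_apply, Matrix.mul_sub, ← Matrix.mul_assoc, ← Matrix.mul_assoc, h.mul_one_sub',
      Matrix.zero_mul, Matrix.zero_mul, sub_zero]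
  have h2 : (1 - P' * P) * (1 + P' * X)⁻¹ = 1 - P' * P := by
    have : (1 - P' * P) * (1 + P' * X) = 1 - P' * P := by
      rw [Matrix.mul_add, Matrix.mul_one, ← Matrix.mul_assoc, h.one_sub_mul', Matrix.zero_mul,
        add_zero]
    conv_lhs => rw [← this]
    rw [mul_nonsing_inv_cancel_right _ _ hX]
  have h3 : (1 - P' * P) * (1 - (1 + P' * X)⁻¹ * (1 - P' * P)) = 0 := by
    rw [Matrix.mul_sub, ← Matrix.mul_assoc, h2, h.one_sub_sq, Matrix.mul_one, sub_self]
  rw [rankRetract, rankRetract, h1, tangentProj_apply, ← add_sub_assoc, Matrix.sub_mul _ _ (1 - _),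
    Matrix.mul_assoc ((1 - P * P') * X), h3, Matrix.mul_zero, sub_zero]

theorem rankRetract_zero (h : IsGInv P P') : rankRetract P P' 0 = P := by
  simp [rankRetract, ← Matrix.mul_assoc, h.mul_mul]

theorem contDiffAt_rankRetract (hX : IsUnit (1 + P' * X).det) {k : ℕ∞ω} :
    ContDiffAt ℝ k (rankRetract P P') X := by
  unfold rankRetract
  have h1 : ContDiffAt ℝ k (fun X : Matrix (Fin dy) (Fin dx) ℝ => 1 + P' * X) X :=
    contDiffAt_const.add (contDiffAt_matrix_mul contDiffAt_const contDiffAt_id)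
  have h2 : ContDiffAt ℝ k (fun X : Matrix (Fin dy) (Fin dx) ℝ => (1 + P' * X)⁻¹) X :=
    ContDiffAt.comp X (contDiffAt_matrix_inv hX) h1
  exact contDiffAt_matrix_mul (contDiffAt_const.add contDiffAt_id)
    (contDiffAt_const.sub (contDiffAt_matrix_mul h2 contDiffAt_const))

/-- A matrix is a smooth point of the matrices of rank at most its own. -/
theorem isSmoothPoint (h : IsGInv P P') {r : ℕ} (hr : P.rank = r) :
    IsSmoothPoint (detVariety dy dx r) P := by
  let T := (tangentProj P P').range
  let d := Module.finrank ℝ T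
  have hfr : Module.finrank ℝ (EuclideanSpace ℝ (Fin d)) = Module.finrank ℝ T := by simp [d]
  let e : EuclideanSpace ℝ (Fin d) ≃L[ℝ] T := ContinuousLinearEquiv.ofFinrankEq hfr
  let ι : EuclideanSpace ℝ (Fin d) →L[ℝ] Matrix (Fin dy) (Fin dx) ℝ := T.subtypeL.comp e.toContinuousLinearMap
  have hι0 : Tendsto ι (𝓝 0) (𝓝 0) := by simpa using ι.continuous.tendsto 0
  have hτι : ∀ x, tangentProj P P' (ι x) = ι x := by
    intro x
    obtain ⟨Y, hY⟩ := (e x).2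
    change tangentProj P P' (e x : Matrix (Fin dy) (Fin dx) ℝ) = (e x : Matrix (Fin dy) (Fin dx) ℝ)
    rw [← hY, h.tangentProj_tangentProj]
  let τ : Matrix (Fin dy) (Fin dx) ℝ →L[ℝ] Matrix (Fin dy) (Fin dx) ℝ := LinearMap.toContinuousLinearMap (tangentProj P P')
  let ρ : Matrix (Fin dy) (Fin dx) ℝ →L[ℝ] EuclideanSpace ℝ (Fin d) :=
    e.symm.toContinuousLinearMap.comp
      (LinearMap.toContinuousLinearMap (tangentProj P P').rangeRestrict)
  have hρ : ∀ X, ι (ρ X) = tangentProj P P' X := fun X => by simp [ι, ρ]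
  have hG := hι0.eventually (eventually_isUnit P')
  let φ : EuclideanSpace ℝ (Fin d) → Matrix (Fin dy) (Fin dx) ℝ := fun x => rankRetract P P' (ι x)
  have hsm : ∀ᶠ x in 𝓝 (0 : EuclideanSpace ℝ (Fin d)), ContDiffAt ℝ ∞ φ x := by
    filter_upwards [hG] with x hx
    exact ContDiffAt.comp x (contDiffAt_rankRetract hx) ι.contDiff.contDiffAt
  have h0 : φ 0 = P := by simp [φ, h.rankRetract_zero]
  have hd := (hsm.self_of_nhds.differentiableAt (by simp)).hasFDerivAt
  refine ⟨d, φ, hsm, h0, ?_, le_antisymm ?_ ?_⟩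
  -- `τ (φ x - P)` equals the injective linear map `ι` near `0`; hence the derivative of `φ` is
  -- injective.
  · have h1 : HasFDerivAt (fun x => τ (φ x - P)) (τ.comp (fderiv ℝ φ 0)) 0 :=
      τ.hasFDerivAt.comp 0 (hd.sub_const P)
    have h2 : HasFDerivAt (fun x => τ (φ x - P)) ι 0 := by
      refine ι.hasFDerivAt.congr_of_eventuallyEq ?_
      filter_upwards [hG] with x hx
      exact (h.tangentProj_rankRetract hx).trans (hτι x)
    have h3 : τ.comp (fderiv ℝ φ 0) = ι := h1.unique h2
    have hinj : Function.Injective ι := Subtype.val_injective.comp e.injective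
    rw [← h3, ContinuousLinearMap.coe_comp] at hinj
    exact Function.Injective.of_comp hinj
  · refine tendsto_nhdsWithin_iff.2 ⟨?_, ?_⟩
    · have := hd.continuousAt.tendsto
      rwa [h0] at this
    · filter_upwards [hG] with x hx
      exact (h.rank_rankRetract_le hx).trans hr.le
  -- `Q ↦ ρ (Q - P)` is a continuous right inverse of `φ` on the variety near `P`.
  · have hρt : Tendsto (fun Q => ρ (Q - P)) (𝓝[detVariety dy dx r] P) (𝓝 0) := by
      have : Continuous fun Q => ρ (Q - P) := by fun_prop
      have := this.tendsto P
      simp only [sub_self, map_zero] at this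
      exact this.mono_left nhdsWithin_le_nhds
    have hsub : Tendsto (fun Q => Q - P) (𝓝 P) (𝓝 0) := by
      have : Continuous fun Q => Q - P := by fun_prop
      simpa using this.tendsto P
    have hev : (fun Q => φ (ρ (Q - P))) =ᶠ[𝓝[detVariety dy dx r] P] id := by
      filter_upwards [self_mem_nhdsWithin,
        nhdsWithin_le_nhds (hsub.eventually (eventually_isUnit P'))] with Q hQ hQ'
      have hQ2 : Q.rank ≤ P.rank := hr ▸ hQ
      simp only [φ, hρ, id]
      rw [h.rankRetract_tangentProj hQ', h.rankRetract_eq hQ' (by simpa using hQ2)]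
      abel
    calc 𝓝[detVariety dy dx r] P = Filter.map (fun Q => φ (ρ (Q - P))) (𝓝[detVariety dy dx r] P) := by
          rw [Filter.map_congr hev, Filter.map_id]
      _ = Filter.map φ (Filter.map (fun Q => ρ (Q - P)) (𝓝[detVariety dy dx r] P)) :=
          (Filter.map_map (m := fun Q => ρ (Q - P)) (m' := φ)).symm
      _ ≤ Filter.map φ (𝓝 0) := Filter.map_mono hρt

end IsGInv

end GeneralizedInverse

/-! ### Second-order expansion of the squared distance along the variety -/

section Expansion

open Asymptotics

theorem isBigO_matrix_mul {α l m n : Type*} [Fintype l] [Fintype m] [Fintype n] {F : Filter α}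
    {f : α → Matrix l m ℝ} {g : α → Matrix m n ℝ} {u v : α → ℝ} (hf : f =O[F] u)
    (hg : g =O[F] v) : (fun x => f x * g x) =O[F] fun x => u x * v x := by
  have h1 : (fun x => f x * g x) =O[F] fun x => ‖f x‖ * ‖g x‖ :=
    IsBigO.of_bound 1 (Eventually.of_forall fun x => by
      simpa using frobenius_norm_mul (f x) (g x))
  exact h1.trans (hf.norm_left.mul hg.norm_left)

variable {dy dx : ℕ} {P Q₀ : Matrix (Fin dy) (Fin dx) ℝ} {P' : Matrix (Fin dx) (Fin dy) ℝ} {r : ℕ}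

/-- The second-order part of the squared distance to `P + R` along the matrices of
rank at most `P.rank`. -/
noncomputable def hessForm (R : Matrix (Fin dy) (Fin dx) ℝ) (P' : Matrix (Fin dx) (Fin dy) ℝ) :
    Matrix (Fin dy) (Fin dx) ℝ →L[ℝ] Matrix (Fin dy) (Fin dx) ℝ →L[ℝ] ℝ :=
  LinearMap.toContinuousBilinearMap <| LinearMap.mk₂ ℝ
    (fun X Y => trace (Xᵀ * Y) - 2 * trace (Rᵀ * (X * P' * Y)))
    (fun X X' Y => by
      simp only [transpose_add, Matrix.add_mul, Matrix.mul_add, trace_add]; ring)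
    (fun c X Y => by
      simp only [transpose_smul, Matrix.smul_mul, Matrix.mul_smul, trace_smul, smul_eq_mul]; ring)
    (fun X Y Y' => by simp only [Matrix.mul_add, trace_add]; ring)
    (fun c X Y => by simp only [Matrix.mul_smul, trace_smul, smul_eq_mul]; ring)

theorem hessForm_apply (R : Matrix (Fin dy) (Fin dx) ℝ) (P' : Matrix (Fin dx) (Fin dy) ℝ)
    (X Y : Matrix (Fin dy) (Fin dx) ℝ) :
    hessForm R P' X Y = trace (Xᵀ * Y) - 2 * trace (Rᵀ * (X * P' * Y)) := rfl

theorem sqDist_sub_sqDist (Q : Matrix (Fin dy) (Fin dx) ℝ) :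
    sqDist Q₀ Q - sqDist Q₀ P = ‖Q - P‖ ^ 2 - 2 * trace ((Q₀ - P)ᵀ * (Q - P)) := by
  have h1 : Q - Q₀ = (Q - P) - (Q₀ - P) := by abel
  rw [sqDist, h1, norm_sub_sq_eq, sqDist, norm_sub_rev P Q₀]
  ring

theorem contDiff_sqDist : ContDiff ℝ 2 (sqDist Q₀) := by
  have : sqDist Q₀ = fun P => ∑ i, ∑ j, (P i j - Q₀ i j) ^ 2 := by
    funext P; rw [sqDist, norm_sq_eq_sum]; rfl
  rw [this]
  refine ContDiff.sum fun i _ => ContDiff.sum fun j _ => ContDiff.pow (ContDiff.sub ?_ ?_) 2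
  · exact (LinearMap.toContinuousLinearMap (Matrix.entryLinearMap ℝ ℝ i j)).contDiff
  · exact contDiff_const

/-- The second-order expansion of the squared distance along the determinantal variety. -/
theorem IsGInv.expansion (h : IsGInv P P') (hr : P.rank = r) (hl : (Q₀ - P)ᵀ * P = 0)
    (hrt : P * (Q₀ - P)ᵀ = 0) :
    (fun Q => sqDist Q₀ Q - sqDist Q₀ P - hessForm (Q₀ - P) P' (Q - P) (Q - P))
      =o[𝓝[detVariety dy dx r] P] fun Q => ‖Q - P‖ ^ 2 := by
  set R := Q₀ - P with hR
  let L : Matrix (Fin dy) (Fin dx) ℝ →L[ℝ] ℝ := LinearMap.toContinuousLinearMap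
    (traceLinearMap (Fin dx) ℝ ℝ ∘ₗ mulLeftLinearMap (Fin dx) ℝ Rᵀ)
  have hL : ∀ X, L X = trace (Rᵀ * X) := fun X => rfl
  have hsub : Tendsto (fun Q => Q - P) (𝓝 P) (𝓝 0) := by
    have : Continuous fun Q => Q - P := by fun_prop
    simpa using this.tendsto P
  have hrem : (fun X : Matrix (Fin dy) (Fin dx) ℝ =>
      2 * L (X * P' * X * P' * X * (1 + P' * X)⁻¹)) =o[𝓝 0] fun X => ‖X‖ ^ 2 := by
    have hX : (fun X : Matrix (Fin dy) (Fin dx) ℝ => X) =O[𝓝 0] fun X => ‖X‖ :=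
      (isBigO_refl _ _).norm_right
    have hc : (fun _ : Matrix (Fin dy) (Fin dx) ℝ => P') =O[𝓝 0] fun _ => (1 : ℝ) :=
      isBigO_const_const _ one_ne_zero _
    have hG : (fun X : Matrix (Fin dy) (Fin dx) ℝ => (1 + P' * X)⁻¹) =O[𝓝 0] fun _ => (1 : ℝ) := by
      have h1 : ContDiffAt ℝ 0 (fun X : Matrix (Fin dy) (Fin dx) ℝ => 1 + P' * X) 0 :=
        contDiffAt_const.add (contDiffAt_matrix_mul contDiffAt_const contDiffAt_id)
      have h2 : ContDiffAt ℝ 0 (fun X : Matrix (Fin dy) (Fin dx) ℝ => (1 + P' * X)⁻¹) 0 :=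
        ContDiffAt.comp 0 (contDiffAt_matrix_inv (by simp)) h1
      exact h2.continuousAt.tendsto.isBigO_one ℝ
    have h3 := (L.isBigO_comp (fun X : Matrix (Fin dy) (Fin dx) ℝ =>
      X * P' * X * P' * X * (1 + P' * X)⁻¹) (𝓝 0)).trans (isBigO_matrix_mul (isBigO_matrix_mul
        (isBigO_matrix_mul (isBigO_matrix_mul (isBigO_matrix_mul hX hc) hX) hc) hX) hG)
    refine (h3.const_mul_left 2).trans_isLittleO ?_
    have h4 : (fun X : Matrix (Fin dy) (Fin dx) ℝ => ‖X‖) =o[𝓝 0] fun _ => (1 : ℝ) := by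
      rw [isLittleO_one_iff]
      exact tendsto_norm_zero
    refine ((isBigO_refl (fun X : Matrix (Fin dy) (Fin dx) ℝ => ‖X‖ ^ 2) (𝓝 0)).mul_isLittleO
      h4).congr (fun X => by ring) (fun X => by ring)
  have hrem' := (hrem.comp_tendsto hsub).mono (nhdsWithin_le_nhds (s := detVariety dy dx r))
  refine hrem'.congr' ?_ EventuallyEq.rfl
  filter_upwards [self_mem_nhdsWithin, nhdsWithin_le_nhds (hsub.eventually
    (IsGInv.eventually_isUnit P'))] with Q hQ hX
  have hQr : (P + (Q - P)).rank ≤ P.rank := by rw [add_sub_cancel, hr]; exact hQ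
  have hS := h.schur_eq_zero hX hQr
  rw [sqDist_sub_sqDist, hessForm_apply, Function.comp_apply, hL, norm_sq_eq_trace]
  generalize Q - P = X at *
  set G := 1 + P' * X with hG
  -- `Rᵀ * P = 0` allows replacing `X` by `P + X`, and `P * Rᵀ = 0` allows inserting `1 - P' * P`;
  -- what results contains the vanishing Schur complement.
  have h1 : trace (Rᵀ * (X * G⁻¹)) = 0 := by
    have hN : (1 - P' * P) * Rᵀ = Rᵀ := by
      rw [Matrix.sub_mul, Matrix.mul_assoc, hrt, Matrix.mul_zero, sub_zero, Matrix.one_mul]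
    calc trace (Rᵀ * (X * G⁻¹)) = trace (Rᵀ * ((P + X) * G⁻¹)) := by
          rw [Matrix.add_mul, Matrix.mul_add, ← Matrix.mul_assoc Rᵀ P, hl, Matrix.zero_mul,
            zero_add]
      _ = trace (((P + X) * G⁻¹) * ((1 - P' * P) * Rᵀ)) := by rw [hN, trace_mul_comm]
      _ = 0 := by rw [← Matrix.mul_assoc, hS, Matrix.zero_mul, trace_zero]
  -- Two steps of the Neumann series of `G⁻¹`, with exact remainder.
  have h2 : X * G⁻¹ = X - X * P' * X + X * P' * X * P' * X * G⁻¹ := by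
    have h3 : ∀ Y : Matrix (Fin dy) (Fin dx) ℝ, Y = Y * G⁻¹ + Y * P' * X * G⁻¹ := fun Y => by
      calc Y = Y * (G * G⁻¹) := by rw [mul_nonsing_inv _ hX, Matrix.mul_one]
        _ = _ := by
          rw [← Matrix.mul_assoc]
          nth_rewrite 1 [hG]
          rw [Matrix.mul_add, Matrix.mul_one, Matrix.add_mul, Matrix.mul_assoc Y P' X]
    have h4 := h3 X
    have h5 := h3 (X * P' * X)
    rw [← sub_eq_iff_eq_add'] at h5
    rw [← h5]
    nth_rewrite 2 [h4]
    abel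
  rw [h2, Matrix.mul_add, Matrix.mul_sub, trace_add, trace_sub] at h1
  linarith

end Expansion

/-! ### First-order conditions along lines in the variety -/

section Stationary

variable {dy dx : ℕ} {P Q₀ : Matrix (Fin dy) (Fin dx) ℝ} {r : ℕ}

theorem rank_add_le (A B : Matrix (Fin dy) (Fin dx) ℝ) : (A + B).rank ≤ A.rank + B.rank := by
  rw [Matrix.rank, Matrix.rank, Matrix.rank, mulVecLin_add]
  exact (Submodule.finrank_mono (LinearMap.range_add_le _ _)).trans
    (Submodule.finrank_add_le_finrank_add_finrank _ _)

theorem hasDerivAt_sqDist_line (X : Matrix (Fin dy) (Fin dx) ℝ) :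
    HasDerivAt (fun t : ℝ => sqDist Q₀ (P + t • X)) (-2 * trace ((Q₀ - P)ᵀ * X)) 0 := by
  have h1 : (fun t : ℝ => sqDist Q₀ (P + t • X)) = fun t : ℝ =>
      sqDist Q₀ P + (t ^ 2 * ‖X‖ ^ 2 - 2 * t * trace ((Q₀ - P)ᵀ * X)) := by
    funext t
    have := sqDist_sub_sqDist (Q₀ := Q₀) (P := P) (P + t • X)
    rw [add_sub_cancel_left, norm_smul, Matrix.mul_smul, trace_smul, smul_eq_mul, mul_pow,
      Real.norm_eq_abs, sq_abs] at this
    linarith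
  rw [h1]
  refine ((((hasDerivAt_id (0 : ℝ)).pow 2).mul_const (‖X‖ ^ 2)).sub
    (((hasDerivAt_id (0 : ℝ)).const_mul 2).mul_const (trace ((Q₀ - P)ᵀ * X)))).const_add _
    |>.congr_deriv ?_
  simp

theorem trace_eq_zero_of_isCriticalOn {S : Set (Matrix (Fin dy) (Fin dx) ℝ)}
    (h : IsCriticalOn (sqDist Q₀) S P) {X : Matrix (Fin dy) (Fin dx) ℝ}
    (hX : ∀ t : ℝ, P + t • X ∈ S) : trace ((Q₀ - P)ᵀ * X) = 0 := by
  linarith [(hasDerivAt_sqDist_line X).unique (h.hasDerivAt_line hX)]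

theorem trace_eq_zero_of_isLocalMinOn {S : Set (Matrix (Fin dy) (Fin dx) ℝ)}
    (h : IsLocalMinOn (sqDist Q₀) S P) {X : Matrix (Fin dy) (Fin dx) ℝ}
    (hX : ∀ t : ℝ, P + t • X ∈ S) : trace ((Q₀ - P)ᵀ * X) = 0 := by
  linarith [isLocalMinOn_hasDerivAt_line h hX (hasDerivAt_sqDist_line X)]

/-- The line consists of the products `(1 + t • A) * P`. Such directions, with those of
`line_mul_right_mem`, span the whole tangent space at a truncation (`IsTruncation.mem_span`). -/
theorem line_mul_left_mem (hP : P ∈ detVariety dy dx r) (A : Matrix (Fin dy) (Fin dy) ℝ) (t : ℝ) :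
    P + t • (A * P) ∈ detVariety dy dx r := by
  have : P + t • (A * P) = (1 + t • A) * P := by
    rw [Matrix.add_mul, Matrix.one_mul, Matrix.smul_mul]
  rw [this]
  exact (rank_mul_le_right _ _).trans hP

theorem line_mul_right_mem (hP : P ∈ detVariety dy dx r) (A : Matrix (Fin dx) (Fin dx) ℝ) (t : ℝ) :
    P + t • (P * A) ∈ detVariety dy dx r := by
  have : P + t • (P * A) = P * (1 + t • A) := by
    rw [Matrix.mul_add, Matrix.mul_one, Matrix.mul_smul]
  rw [this]
  exact (rank_mul_le_left _ _).trans hP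

/-- A point that is stationary along all lines of the determinantal variety has rank `r`,
and its row and column spaces are orthogonal to those of the residual. -/
theorem rank_eq_and_orthogonal_of_stationary (hQ₀ : Q₀ ∉ detVariety dy dx r)
    (hP : P ∈ detVariety dy dx r)
    (hstat : ∀ X, (∀ t : ℝ, P + t • X ∈ detVariety dy dx r) → trace ((Q₀ - P)ᵀ * X) = 0) :
    P.rank = r ∧ (Q₀ - P)ᵀ * P = 0 ∧ P * (Q₀ - P)ᵀ = 0 := by
  have hz : ∀ {a b : ℕ} (M : Matrix (Fin a) (Fin b) ℝ), trace (M * Mᵀ) = 0 → M = 0 := by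
    intro a b M hM
    rw [trace_mul_comm, ← norm_sq_eq_trace] at hM
    simpa using hM
  refine ⟨le_antisymm hP ?_, hz _ ?_, hz _ ?_⟩
  -- Below rank `r` a multiple of a matrix unit can be added without leaving the variety, so every
  -- entry of `Q₀ - P` vanishes.
  · by_contra hlt
    push Not at hlt
    apply hQ₀
    suffices Q₀ - P = 0 by rwa [sub_eq_zero.1 this]
    ext i j
    have h1 := hstat (Matrix.single i j 1) fun t => by
      have h2 : t • Matrix.single i j (1 : ℝ) =
          vecMulVec (t • Pi.single i 1) (Pi.single j 1) := by
        rw [single_eq_single_vecMulVec_single, smul_vecMulVec]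
      have := rank_add_le P (t • Matrix.single i j (1 : ℝ))
      have h3 : (t • Matrix.single i j (1 : ℝ)).rank ≤ 1 := by
        rw [h2]; exact rank_vecMulVec_le _ _
      change Matrix.rank _ ≤ r
      omega
    simpa [trace_mul_single] using h1
  -- The direction is chosen so that the trace becomes the squared norm of `(Q₀ - P)ᵀ * P`.
  · have := hstat _ (line_mul_right_mem hP ((Q₀ - P)ᵀ * P)ᵀ)
    rwa [← Matrix.mul_assoc] at this
  · have := hstat _ (line_mul_left_mem hP (P * (Q₀ - P)ᵀ)ᵀ)
    rwa [trace_mul_comm, Matrix.mul_assoc, trace_mul_comm] at this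

end Stationary

/-! ### Passage from full to thin singular value decompositions -/

section ThinForm

variable {dy dx : ℕ}

/-- The first `min dy dx` columns of a `dy × dy` matrix. -/
def leftCols (dx : ℕ) (U : Matrix (Fin dy) (Fin dy) ℝ) : Matrix (Fin dy) (Fin (min dy dx)) ℝ :=
  U.submatrix id (Fin.castLE (min_le_left dy dx))

/-- The first `min dy dx` columns of a `dx × dx` matrix. -/
def rightCols (dy : ℕ) (V : Matrix (Fin dx) (Fin dx) ℝ) : Matrix (Fin dx) (Fin (min dy dx)) ℝ :=
  V.submatrix id (Fin.castLE (min_le_right dy dx))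

theorem transpose_mul_submatrix {n m : ℕ} {U : Matrix (Fin n) (Fin n) ℝ}
    (hU : U ∈ Matrix.orthogonalGroup (Fin n) ℝ) {f : Fin m → Fin n} (hf : Function.Injective f) :
    (U.submatrix id f)ᵀ * U.submatrix id f = 1 := by
  have h1 : Uᵀ * U = 1 := (mem_orthogonalGroup_iff' _ _).1 hU
  ext i j
  have h2 := congrFun (congrFun h1 (f i)) (f j)
  rw [one_apply] at h2 ⊢
  simp only [hf.eq_iff] at h2
  rw [← h2]
  rfl

theorem leftCols_orthonormal {U : Matrix (Fin dy) (Fin dy) ℝ}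
    (hU : U ∈ Matrix.orthogonalGroup (Fin dy) ℝ) : (leftCols dx U)ᵀ * leftCols dx U = 1 :=
  transpose_mul_submatrix hU (Fin.castLE_injective _)

theorem rightCols_orthonormal {V : Matrix (Fin dx) (Fin dx) ℝ}
    (hV : V ∈ Matrix.orthogonalGroup (Fin dx) ℝ) : (rightCols dy V)ᵀ * rightCols dy V = 1 :=
  transpose_mul_submatrix hV (Fin.castLE_injective _)

/-- Columns of `U` and `V` beyond `min dy dx` meet only zeros. Dropping them leaves a square
diagonal matrix. -/
theorem mul_rectDiag_mul (U : Matrix (Fin dy) (Fin dy) ℝ) (V : Matrix (Fin dx) (Fin dx) ℝ)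
    (τ : Fin (min dy dx) → ℝ) :
    U * rectDiag τ * Vᵀ = leftCols dx U * diagonal τ * (rightCols dy V)ᵀ := by
  have h1 : rectDiag τ = leftCols dx (1 : Matrix (Fin dy) (Fin dy) ℝ) * diagonal τ *
      (rightCols dy (1 : Matrix (Fin dx) (Fin dx) ℝ))ᵀ := by
    ext i j
    rw [mul_apply]
    simp only [rectDiag, of_apply, mul_diagonal, leftCols,
      rightCols, submatrix_apply, id, transpose_apply, one_apply]
    split_ifs with h
    · rw [Finset.sum_eq_single ⟨i.val, lt_min i.isLt (h ▸ j.isLt)⟩]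
      · have h1 : i = Fin.castLE (min_le_left dy dx) ⟨i.val, lt_min i.isLt (h ▸ j.isLt)⟩ := rfl
        have h2 : j = Fin.castLE (min_le_right dy dx) ⟨i.val, lt_min i.isLt (h ▸ j.isLt)⟩ :=
          Fin.ext h.symm
        rw [if_pos h1, if_pos h2]; ring
      · intro k _ hk
        rw [if_neg, zero_mul, zero_mul]
        rintro rfl
        exact hk (Fin.ext rfl)
      · simp
    · symm
      refine Finset.sum_eq_zero fun k _ => ?_
      by_cases h1 : i = Fin.castLE (min_le_left dy dx) k
      · rw [if_neg (c := j = _), mul_zero]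
        rintro rfl
        exact h (by rw [h1]; rfl)
      · rw [if_neg h1, zero_mul, zero_mul]
  have h2 : U * leftCols dx (1 : Matrix (Fin dy) (Fin dy) ℝ) = leftCols dx U := by
    ext i k; simp [leftCols, mul_apply, one_apply]
  have h3 : V * rightCols dy (1 : Matrix (Fin dx) (Fin dx) ℝ) = rightCols dy V := by
    ext i k; simp [rightCols, mul_apply, one_apply]
  rw [h1, ← h3, transpose_mul, ← h2]
  simp only [Matrix.mul_assoc]

theorem mul_diagonal_mul_eq_sum {n m k : Type*} [Fintype k] [DecidableEq k]
    (U : Matrix n k ℝ) (V : Matrix m k ℝ) (τ : k → ℝ) :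
    U * diagonal τ * Vᵀ = ∑ i, τ i • vecMulVec (U.col i) (V.col i) := by
  ext a b
  rw [mul_apply, Matrix.sum_apply]
  refine Finset.sum_congr rfl fun i _ => ?_
  simp only [mul_diagonal, transpose_apply, Matrix.smul_apply, vecMulVec_apply, col_apply, smul_eq_mul]
  ring

end ThinForm

/-! ### Existence of singular value decompositions with prescribed truncations -/

section Existence

/-- Every real matrix is a positive combination of rank-one matrices built from orthonormal
families of singular vectors. -/
theorem exists_thin_svd {dy dx : ℕ} (A : Matrix (Fin dy) (Fin dx) ℝ) :
    ∃ (J : Type) (_ : Fintype J) (u : J → EuclideanSpace ℝ (Fin dy))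
      (v : J → EuclideanSpace ℝ (Fin dx)) (s : J → ℝ), Orthonormal ℝ u ∧ Orthonormal ℝ v ∧
      (∀ j, 0 < s j) ∧ (∀ j, A *ᵥ (v j).ofLp = s j • (u j).ofLp) ∧
      (∀ j, Aᵀ *ᵥ (u j).ofLp = s j • (v j).ofLp) ∧
      A = ∑ j, s j • vecMulVec (u j).ofLp (v j).ofLp := by
  classical
  have hpsd : (Aᵀ * A).PosSemidef := by
    have := posSemidef_conjTranspose_mul_self A
    rwa [conjTranspose_eq_transpose_of_trivial] at this
  have hA := hpsd.isHermitian
  set b := hA.eigenvectorBasis with hb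
  set ev := hA.eigenvalues with hev
  have hAb : ∀ i, Aᵀ *ᵥ (A *ᵥ (b i).ofLp) = ev i • (b i).ofLp := fun i => by
    rw [mulVec_mulVec]; exact hA.mulVec_eigenvectorBasis i
  have hin : ∀ i j, (A *ᵥ (b i).ofLp) ⬝ᵥ (A *ᵥ (b j).ofLp) = if i = j then ev i else 0 := by
    intro i j
    have h1 : (b i).ofLp ⬝ᵥ (b j).ofLp = if i = j then 1 else 0 := by
      have := orthonormal_iff_ite.1 b.orthonormal j i
      rw [EuclideanSpace.inner_eq_star_dotProduct, star_trivial] at this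
      rw [this]; simp only [eq_comm]
    rw [dotProduct_mulVec, ← mulVec_transpose, hAb, smul_dotProduct, h1]
    simp
  have h0 : ∀ i, ¬ 0 < ev i → A *ᵥ (b i).ofLp = 0 := fun i hi => by
    have h1 := hin i i
    rw [if_pos rfl, le_antisymm (not_lt.1 hi) (hpsd.eigenvalues_nonneg i)] at h1
    exact dotProduct_self_eq_zero.1 h1
  have hs : ∀ i : {i // 0 < ev i}, 0 < √(ev i) := fun i => Real.sqrt_pos.2 i.2
  -- Right singular vectors are the eigenvectors `b i` of `Aᵀ * A` with positive eigenvalue, left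
  -- ones their normalized images. The other eigenvectors are killed by `A`, by `h0`.
  refine ⟨{i // 0 < ev i}, inferInstance, fun i => WithLp.toLp 2 ((√(ev i))⁻¹ • A *ᵥ (b i).ofLp),
    fun i => b i, fun i => √(ev i), ?_, b.orthonormal.comp _ Subtype.val_injective, hs, ?_, ?_, ?_⟩
  · rw [orthonormal_iff_ite]
    intro i j
    rw [EuclideanSpace.inner_eq_star_dotProduct, star_trivial]
    simp only [smul_dotProduct, dotProduct_smul, hin, smul_eq_mul, Subtype.val_inj]
    by_cases hij : i = j
    · subst hij
      have := (hs i).ne'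
      rw [if_pos rfl, if_pos rfl]
      field_simp
      exact (Real.sq_sqrt i.2.le).symm
    · rw [if_neg hij, if_neg (Ne.symm hij)]; simp
  · intro i
    simp only [smul_smul]
    rw [mul_inv_cancel₀ (hs i).ne', one_smul]
  · intro i
    simp only [mulVec_smul, hAb, smul_smul]
    congr 1
    have := (hs i).ne'
    field_simp
    exact (Real.sq_sqrt i.2.le).symm
  · refine (Matrix.ext_iff_mulVec).2 fun w => ?_
    have hw : w = ∑ i, ((b i).ofLp ⬝ᵥ w) • (b i).ofLp := by
      have := congrArg WithLp.ofLp (b.sum_repr' (WithLp.toLp 2 w))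
      simp only [EuclideanSpace.inner_eq_star_dotProduct, star_trivial, WithLp.ofLp_sum,
        WithLp.ofLp_smul] at this
      conv_lhs => rw [← this]
      exact Finset.sum_congr rfl fun i _ => by rw [dotProduct_comm w]
    have h1 : A *ᵥ w = ∑ i, ((b i).ofLp ⬝ᵥ w) • A *ᵥ (b i).ofLp := by
      conv_lhs => rw [hw]
      rw [← mulVecLin_apply, map_sum]
      simp
    have h2 : ∀ i : {i // 0 < ev i}, √(ev i) • vecMulVec ((√(ev i))⁻¹ • A *ᵥ (b i).ofLp)
        (b i).ofLp = vecMulVec (A *ᵥ (b i).ofLp) (b i).ofLp := fun i => by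
      rw [smul_vecMulVec, smul_smul, mul_inv_cancel₀ (hs i).ne', one_smul]
    simp only [h2]
    rw [h1, sum_mulVec]
    simp only [vecMulVec_mulVec]
    rw [← Finset.sum_filter_of_ne (p := fun i => 0 < ev i) (fun i _ hi => by
      by_contra hn; exact hi (by rw [h0 i hn, smul_zero])),
      Finset.sum_subtype (F := inferInstance) (p := fun i => 0 < ev i) _ (by simp)]
    simp

theorem exists_antitone_equiv {J K : Type*} [Fintype J] [LinearOrder K] (κ : J → K) :
    ∃ e : Fin (Fintype.card J) ≃ J, Antitone (κ ∘ e) := by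
  let e₀ := Fintype.equivFin J
  let f : Fin (Fintype.card J) → Kᵒᵈ := fun i => OrderDual.toDual (κ (e₀.symm i))
  exact ⟨(Tuple.sort f).trans e₀.symm, fun i j hij => Tuple.monotone_sort f hij⟩

theorem eq_firstIdx_of_isLowerSet {n : ℕ} {T : Finset (Fin n)}
    (hT : ∀ i j, i ≤ j → j ∈ T → i ∈ T) : T = firstIdx n T.card := by
  have hc : T.card ≤ n := by simpa using Finset.card_le_univ T
  refine Finset.eq_of_subset_of_card_le (fun i hi => ?_) ?_
  · rw [firstIdx, Finset.mem_filter]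
    refine ⟨Finset.mem_univ _, ?_⟩
    have : Finset.Iic i ⊆ T := fun j hj => hT j i (Finset.mem_Iic.1 hj) hi
    have := Finset.card_le_card this
    -- `Finset.Iic i` has `i + 1` elements, which gives the strict inequality `i < T.card`.
    rw [Fin.card_Iic] at this
    omega
  · rw [firstIdx, Fin.card_filter_val_lt]
    omega

theorem exists_orthogonal_extension {n d : ℕ} {u : Fin n → EuclideanSpace ℝ (Fin d)}
    (hu : Orthonormal ℝ u) (h : n ≤ d) : ∃ U ∈ Matrix.orthogonalGroup (Fin d) ℝ,
      ∀ i, U.col (Fin.castLE h i) = (u i).ofLp := by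
  classical
  let w : Fin d → EuclideanSpace ℝ (Fin d) := fun k => if hk : k.val < n then u ⟨k, hk⟩ else 0
  let s : Set (Fin d) := {k | k.val < n}
  have hw : Orthonormal ℝ (s.domRestrict w) := by
    have : s.domRestrict w = u ∘ fun k : s => (⟨k.1, k.2⟩ : Fin n) := by
      funext k
      have hk : k.1.val < n := k.2
      simp [w, Set.domRestrict, hk]
    rw [this]
    refine hu.comp _ fun a b hab => ?_
    exact Subtype.ext (Fin.ext (Fin.mk.inj_iff.1 hab))
  obtain ⟨b, hb⟩ := hw.exists_orthonormalBasis_extension_of_card_eq (by simp)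
  refine ⟨of fun i k => b k i, ?_, fun i => ?_⟩
  · rw [mem_orthogonalGroup_iff']
    ext i j
    have h1 := orthonormal_iff_ite.1 b.orthonormal j i
    rw [EuclideanSpace.inner_eq_star_dotProduct, star_trivial] at h1
    rw [one_apply]
    simp only [eq_comm] at h1
    rw [h1]
    rfl
  · have h1 : (Fin.castLE h i) ∈ s := i.2
    have h2 := hb _ h1
    have h3 : w (Fin.castLE h i) = u i := by simp [w]
    rw [← h3, ← h2]
    rfl

/-- A nonnegative combination of rank-one matrices, with orthonormal singular vectors, extends
to a full singular value decomposition, compatibly with partial sums. -/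
theorem exists_svd_of_antitone {dy dx n : ℕ} {u : Fin n → EuclideanSpace ℝ (Fin dy)}
    {v : Fin n → EuclideanSpace ℝ (Fin dx)} {s : Fin n → ℝ} (hu : Orthonormal ℝ u)
    (hv : Orthonormal ℝ v) (hs : ∀ i, 0 ≤ s i) (hanti : Antitone s) :
    ∃ (h : n ≤ min dy dx) (U : Matrix (Fin dy) (Fin dy) ℝ) (σ : Fin (min dy dx) → ℝ)
      (V : Matrix (Fin dx) (Fin dx) ℝ),
      IsSVD (∑ i, s i • vecMulVec (u i).ofLp (v i).ofLp) U σ V ∧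
      (∀ i, σ (Fin.castLE h i) = s i) ∧
      ∀ A : Finset (Fin n), ∑ i ∈ A, s i • vecMulVec (u i).ofLp (v i).ofLp =
        U * rectDiagOn σ (A.map (Fin.castLEEmb h)) * Vᵀ := by
  have hy : n ≤ dy := by simpa using hu.linearIndependent.fintype_card_le_finrank
  have hx : n ≤ dx := by simpa using hv.linearIndependent.fintype_card_le_finrank
  have h : n ≤ min dy dx := le_min hy hx
  obtain ⟨U, hU, hUu⟩ := exists_orthogonal_extension hu hy
  obtain ⟨V, hV, hVv⟩ := exists_orthogonal_extension hv hx
  -- Padding by zeros keeps the sequence decreasing because `s` is nonnegative.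
  let σ : Fin (min dy dx) → ℝ := fun k => if hk : k.val < n then s ⟨k, hk⟩ else 0
  have hσ : ∀ i, σ (Fin.castLE h i) = s i := fun i => by simp [σ]
  have hσ0 : ∀ k, 0 ≤ σ k := fun k => by
    by_cases hk : k.val < n
    · simpa [σ, hk] using hs _
    · simp [σ, hk]
  have key : ∀ A : Finset (Fin n), ∑ i ∈ A, s i • vecMulVec (u i).ofLp (v i).ofLp =
        U * rectDiagOn σ (A.map (Fin.castLEEmb h)) * Vᵀ := fun A => by
    rw [rectDiagOn, mul_rectDiag_mul, mul_diagonal_mul_eq_sum]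
    simp only [ite_smul, zero_smul]
    rw [Finset.sum_ite_mem, Finset.univ_inter, Finset.sum_map]
    refine Finset.sum_congr rfl fun i _ => ?_
    rw [Fin.coe_castLEEmb, hσ, ← hUu, ← hVv]
    rfl
  refine ⟨h, U, σ, V, ⟨hU, hV, ?_, hσ0, ?_⟩, hσ, key⟩
  · intro k l hkl
    by_cases hl : l.val < n
    · have hk : k.val < n := lt_of_le_of_lt hkl hl
      simp only [σ, hl, hk, dif_pos]
      exact hanti hkl
    · simpa [σ, hl] using hσ0 k
  · rw [key Finset.univ]
    congr 2
    rw [rectDiagOn]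
    congr 1
    funext k
    split_ifs with hk
    · rfl
    · by_cases hkn : k.val < n
      · exact absurd (Finset.mem_map.2 ⟨(⟨k, hkn⟩ : Fin n), Finset.mem_univ _, Fin.ext rfl⟩) hk
      · simp [σ, hkn]

variable {dy dx : ℕ} {J : Type*} [Fintype J] {u : J → EuclideanSpace ℝ (Fin dy)}
  {v : J → EuclideanSpace ℝ (Fin dx)} {s : J → ℝ}

theorem exists_svd_of_family (hu : Orthonormal ℝ u) (hv : Orthonormal ℝ v) (hs : ∀ i, 0 ≤ s i)
    (A : Finset J) :
    ∃ (U : Matrix (Fin dy) (Fin dy) ℝ) (σ : Fin (min dy dx) → ℝ)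
      (V : Matrix (Fin dx) (Fin dx) ℝ) (I : Finset (Fin (min dy dx))),
      IsSVD (∑ i, s i • vecMulVec (u i).ofLp (v i).ofLp) U σ V ∧ I.card = A.card ∧
      (∀ i ∈ I, ∃ j ∈ A, σ i = s j) ∧
      ∑ i ∈ A, s i • vecMulVec (u i).ofLp (v i).ofLp = U * rectDiagOn σ I * Vᵀ := by
  obtain ⟨e, he⟩ := exists_antitone_equiv s
  obtain ⟨h, U, σ, V, hsvd, hσ, hA⟩ := exists_svd_of_antitone (hu.comp e e.injective)
    (hv.comp e e.injective) (fun i => hs (e i)) he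
  refine ⟨U, σ, V, (A.map e.symm.toEmbedding).map (Fin.castLEEmb h), ?_, by simp, ?_, ?_⟩
  · convert hsvd using 1
    exact (Equiv.sum_comp e fun i => s i • vecMulVec (u i).ofLp (v i).ofLp).symm
  · intro i hi
    simp only [Finset.mem_map, exists_exists_and_eq_and] at hi
    obtain ⟨j, hj, rfl⟩ := hi
    exact ⟨j, hj, by simp [hσ]⟩
  · rw [← hA, Finset.sum_map]
    simp

theorem exists_svd_firstIdx (hu : Orthonormal ℝ u) (hv : Orthonormal ℝ v) (hs : ∀ i, 0 ≤ s i)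
    {A : Finset J} (hA : ∀ j ∈ A, ∀ a ∉ A, s a ≤ s j) :
    ∃ (U : Matrix (Fin dy) (Fin dy) ℝ) (σ : Fin (min dy dx) → ℝ) (V : Matrix (Fin dx) (Fin dx) ℝ),
      IsSVD (∑ i, s i • vecMulVec (u i).ofLp (v i).ofLp) U σ V ∧
      ∑ i ∈ A, s i • vecMulVec (u i).ofLp (v i).ofLp =
        U * rectDiagOn σ (firstIdx (min dy dx) A.card) * Vᵀ := by
  classical
  -- Sorting by membership in `A` first and by `s` second makes `A` an initial segment even when
  -- there are ties. By `hA`, `s` is still decreasing in this order.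
  obtain ⟨e, he⟩ := exists_antitone_equiv fun j => toLex ((if j ∈ A then 1 else 0 : ℕ), s j)
  have hlow : ∀ i k, i ≤ k → e k ∈ A → e i ∈ A := by
    intro i k hik hk
    by_contra hi
    have := he hik
    simp [Prod.Lex.toLex_le_toLex, hi, hk] at this
  have hanti : Antitone (s ∘ e) := by
    intro i k hik
    have h1 := he hik
    by_cases hk : e k ∈ A
    · have hi := hlow i k hik hk
      simpa [Prod.Lex.toLex_le_toLex, hi, hk] using h1
    · by_cases hi : e i ∈ A
      · exact hA _ hi _ hk
      · simpa [Prod.Lex.toLex_le_toLex, hi, hk] using h1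
  obtain ⟨h, U, σ, V, hsvd, hσ, hB⟩ := exists_svd_of_antitone (hu.comp e e.injective)
    (hv.comp e e.injective) (fun i => hs (e i)) hanti
  refine ⟨U, σ, V, ?_, ?_⟩
  · convert hsvd using 1
    exact (Equiv.sum_comp e fun i => s i • vecMulVec (u i).ofLp (v i).ofLp).symm
  · have h1 : firstIdx (min dy dx) A.card =
        (A.map e.symm.toEmbedding).map (Fin.castLEEmb h) := by
      have := eq_firstIdx_of_isLowerSet (T := (A.map e.symm.toEmbedding).map (Fin.castLEEmb h)) ?_
      · rw [this]; simp
      · intro i j hij hj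
        simp only [Finset.mem_map, exists_exists_and_eq_and] at hj ⊢
        obtain ⟨a, ha, rfl⟩ := hj
        have hin : i.val < Fintype.card J := lt_of_le_of_lt hij (e.symm a).2
        refine ⟨e ⟨i, hin⟩, hlow _ (e.symm a) hij (by simpa using ha), ?_⟩
        exact Fin.ext (by simp)
    rw [h1, ← hB, Finset.sum_map]
    simp

end Existence

/-! ### The Hessian form in singular coordinates and its inversions -/

section DiagonalForm

open Asymptotics

variable {dy dx m r : ℕ} {U : Matrix (Fin dy) (Fin m) ℝ} {V : Matrix (Fin dx) (Fin m) ℝ}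

theorem mul_mul_mul_mul_cancel {a b c : ℕ} {W : Matrix (Fin c) (Fin m) ℝ} (hW : Wᵀ * W = 1)
    (A : Matrix (Fin a) (Fin m) ℝ) (B : Matrix (Fin m) (Fin b) ℝ) :
    (A * Wᵀ) * (W * B) = A * B := by
  rw [Matrix.mul_assoc, ← Matrix.mul_assoc Wᵀ, hW, Matrix.one_mul]

theorem conj_conj (hU : Uᵀ * U = 1) (hV : Vᵀ * V = 1) (Z : Matrix (Fin m) (Fin m) ℝ) :
    Uᵀ * (U * Z * Vᵀ) * V = Z := by
  rw [Matrix.mul_assoc U, ← Matrix.mul_assoc Uᵀ, hU, Matrix.one_mul, Matrix.mul_assoc, hV,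
    Matrix.mul_one]

theorem norm_conj (hU : Uᵀ * U = 1) (hV : Vᵀ * V = 1) (Z : Matrix (Fin m) (Fin m) ℝ) :
    ‖U * Z * Vᵀ‖ ^ 2 = ‖Z‖ ^ 2 := by
  rw [norm_sq_eq_trace, norm_sq_eq_trace]
  have h1 : (U * Z * Vᵀ)ᵀ * (U * Z * Vᵀ) = V * (Zᵀ * Z * Vᵀ) := by
    simp only [transpose_mul, transpose_transpose, Matrix.mul_assoc]
    rw [← Matrix.mul_assoc Uᵀ, hU, Matrix.one_mul]
  rw [h1, trace_mul_comm, Matrix.mul_assoc, hV, Matrix.mul_one]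

/-- Pythagoras for the orthogonal projection `U * Uᵀ`: the difference of the two sides is `‖X - U *
(Uᵀ * X)‖ ^ 2`. -/
theorem norm_transpose_mul_le {b : ℕ} (hU : Uᵀ * U = 1) (X : Matrix (Fin dy) (Fin b) ℝ) :
    ‖Uᵀ * X‖ ^ 2 ≤ ‖X‖ ^ 2 := by
  have h1 := norm_sub_sq_eq X (U * (Uᵀ * X))
  have h2 : ‖U * (Uᵀ * X)‖ ^ 2 = ‖Uᵀ * X‖ ^ 2 := by
    rw [norm_sq_eq_trace, norm_sq_eq_trace, transpose_mul, mul_mul_mul_mul_cancel hU]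
  have h3 : trace ((U * (Uᵀ * X))ᵀ * X) = ‖Uᵀ * X‖ ^ 2 := by
    rw [norm_sq_eq_trace, transpose_mul U, Matrix.mul_assoc]
  rw [h2, h3] at h1
  linarith [sq_nonneg ‖X - U * (Uᵀ * X)‖]

theorem norm_conj_transpose_le (hU : Uᵀ * U = 1) (hV : Vᵀ * V = 1)
    (X : Matrix (Fin dy) (Fin dx) ℝ) : ‖Uᵀ * X * V‖ ^ 2 ≤ ‖X‖ ^ 2 := by
  have h1 : (Uᵀ * X * V) = (Vᵀ * (Uᵀ * X)ᵀ)ᵀ := by rw [transpose_mul]; simp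
  rw [h1, frobenius_norm_transpose]
  refine (norm_transpose_mul_le hV _).trans ?_
  rw [frobenius_norm_transpose]
  exact norm_transpose_mul_le hU X

theorem rank_diagonal_conj (hU : Uᵀ * U = 1) (hV : Vᵀ * V = 1) (τ : Fin m → ℝ) :
    (U * diagonal τ * Vᵀ).rank = (Finset.univ.filter fun i => τ i ≠ 0).card := by
  have h1 : (diagonal τ).rank = (Finset.univ.filter fun i => τ i ≠ 0).card := by
    rw [rank_diagonal, Fintype.card_subtype]
  rw [← h1]
  apply le_antisymm
  · exact (rank_mul_le_left _ _).trans (rank_mul_le_right _ _)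
  · conv_lhs => rw [← conj_conj hU hV (diagonal τ)]
    exact (rank_mul_le_left _ _).trans (rank_mul_le_right _ _)

/-- The convention `0⁻¹ = 0` makes the entrywise inverse of a diagonal a generalized inverse, also
where `τ` vanishes. -/
theorem isGInv_diagonal_conj (hU : Uᵀ * U = 1) (hV : Vᵀ * V = 1) (τ : Fin m → ℝ) :
    IsGInv (U * diagonal τ * Vᵀ) (V * diagonal (fun i => (τ i)⁻¹) * Uᵀ) where
  mul_mul := by
    rw [Matrix.mul_assoc V, mul_mul_mul_mul_cancel hV, Matrix.mul_assoc U (diagonal τ) Vᵀ,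
      ← Matrix.mul_assoc (U * diagonal τ), mul_mul_mul_mul_cancel hU]
    simp only [Matrix.mul_assoc]
    rw [← Matrix.mul_assoc (diagonal _) (diagonal _) Vᵀ, diagonal_mul_diagonal,
      ← Matrix.mul_assoc (diagonal _) (diagonal _) Vᵀ, diagonal_mul_diagonal]
    congr 3
    funext i
    by_cases h : τ i = 0
    · simp [h]
    · field_simp
  mul_mul' := by
    rw [Matrix.mul_assoc U, mul_mul_mul_mul_cancel hU, Matrix.mul_assoc V (diagonal _) Uᵀ,
      ← Matrix.mul_assoc (V * diagonal _), mul_mul_mul_mul_cancel hV]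
    simp only [Matrix.mul_assoc]
    rw [← Matrix.mul_assoc (diagonal _) (diagonal _) Uᵀ, diagonal_mul_diagonal,
      ← Matrix.mul_assoc (diagonal _) (diagonal _) Uᵀ, diagonal_mul_diagonal]
    congr 3
    funext i
    by_cases h : τ i = 0
    · simp [h]
    · field_simp

theorem hessForm_diagonal_conj (ρ τ : Fin m → ℝ) (X : Matrix (Fin dy) (Fin dx) ℝ) :
    hessForm (U * diagonal ρ * Vᵀ) (V * diagonal τ * Uᵀ) X X =
      ‖X‖ ^ 2 - 2 * ∑ a, ∑ j, ρ a * τ j * ((Uᵀ * X * V) a j * (Uᵀ * X * V) j a) := by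
  rw [hessForm_apply, ← norm_sq_eq_trace]
  congr 2
  set Y := Uᵀ * X * V with hY
  have h1 : trace ((U * diagonal ρ * Vᵀ)ᵀ * (X * (V * diagonal τ * Uᵀ) * X)) =
      trace ((diagonal ρ * Y) * (diagonal τ * Y)) := by
    have h2 : (U * diagonal ρ * Vᵀ)ᵀ * (X * (V * diagonal τ * Uᵀ) * X) =
        V * (diagonal ρ * (Uᵀ * X * V) * (diagonal τ * (Uᵀ * X))) := by
      simp only [transpose_mul, transpose_transpose, diagonal_transpose, Matrix.mul_assoc]
    rw [h2, trace_mul_comm]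
    simp only [hY, Matrix.mul_assoc]
  rw [h1, trace]
  simp only [diag_apply, mul_apply (M := diagonal ρ * Y), diagonal_mul]
  exact Finset.sum_congr rfl fun a _ => Finset.sum_congr rfl fun j _ => by ring

/-- The part of the vector `σ` supported on `I`. -/
def restrictTo (σ : Fin m → ℝ) (I : Finset (Fin m)) : Fin m → ℝ := fun i => if i ∈ I then σ i else 0

variable {σ : Fin m → ℝ} {I : Finset (Fin m)}

theorem filter_restrictTo_ne_zero (hI : ∀ i ∈ I, 0 < σ i) :
    (Finset.univ.filter fun i => restrictTo σ I i ≠ 0) = I := by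
  ext i
  by_cases h : i ∈ I
  · simp [restrictTo, h, (hI i h).ne']
  · simp [restrictTo, h]

theorem sub_restrictTo : U * diagonal σ * Vᵀ - U * diagonal (restrictTo σ I) * Vᵀ =
    U * diagonal (restrictTo σ Iᶜ) * Vᵀ := by
  rw [← Matrix.sub_mul, ← Matrix.mul_sub, diagonal_sub]
  congr 3
  funext i
  by_cases h : i ∈ I <;> simp [restrictTo, h]

theorem diagonal_restrictTo_mul (ρ τ : Fin m → ℝ) :
    diagonal (restrictTo ρ Iᶜ) * diagonal (restrictTo τ I) = 0 := by
  rw [diagonal_mul_diagonal, diagonal_eq_zero]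
  funext i
  by_cases h : i ∈ I <;> simp [restrictTo, h]

variable {Q₀ P : Matrix (Fin dy) (Fin dx) ℝ}

/-- The data of a truncated singular value decomposition in thin form: `Q₀ = U diag(σ) Vᵀ` with
orthonormal columns, and `P = U diag(σ_I) Vᵀ` with `σ` positive on the set `I` of size `r`. -/
structure IsTruncation (Q₀ P : Matrix (Fin dy) (Fin dx) ℝ) (r : ℕ) (U : Matrix (Fin dy) (Fin m) ℝ)
    (σ : Fin m → ℝ) (V : Matrix (Fin dx) (Fin m) ℝ) (I : Finset (Fin m)) : Prop where
  left : Uᵀ * U = 1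
  right : Vᵀ * V = 1
  nonneg : ∀ i, 0 ≤ σ i
  pos : ∀ i ∈ I, 0 < σ i
  card : I.card = r
  eq : Q₀ = U * diagonal σ * Vᵀ
  eq_trunc : P = U * diagonal (restrictTo σ I) * Vᵀ

namespace IsTruncation

theorem rank (h : IsTruncation Q₀ P r U σ V I) : P.rank = r := by
  rw [h.eq_trunc, rank_diagonal_conj h.left h.right, filter_restrictTo_ne_zero h.pos, h.card]

theorem mem (h : IsTruncation Q₀ P r U σ V I) : P ∈ detVariety dy dx r := h.rank.le

theorem sub_eq (h : IsTruncation Q₀ P r U σ V I) :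
    Q₀ - P = U * diagonal (restrictTo σ Iᶜ) * Vᵀ := by
  rw [h.eq, h.eq_trunc, sub_restrictTo]

/-- The generalized inverse of the truncation. -/
noncomputable def gInv (_ : IsTruncation Q₀ P r U σ V I) : Matrix (Fin dx) (Fin dy) ℝ :=
  V * diagonal (fun i => (restrictTo σ I i)⁻¹) * Uᵀ

theorem isGInv (h : IsTruncation Q₀ P r U σ V I) : IsGInv P h.gInv := by
  have := isGInv_diagonal_conj h.left h.right (restrictTo σ I)
  rwa [← h.eq_trunc] at this

theorem residual_transpose_mul (h : IsTruncation Q₀ P r U σ V I) : (Q₀ - P)ᵀ * P = 0 := by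
  rw [h.sub_eq, h.eq_trunc, transpose_mul, transpose_mul, diagonal_transpose, transpose_transpose,
    Matrix.mul_assoc U, ← Matrix.mul_assoc V, mul_mul_mul_mul_cancel h.left, Matrix.mul_assoc V,
    ← Matrix.mul_assoc (diagonal _), diagonal_restrictTo_mul, Matrix.zero_mul, Matrix.mul_zero]

theorem mul_residual_transpose (h : IsTruncation Q₀ P r U σ V I) : P * (Q₀ - P)ᵀ = 0 := by
  have h1 : (Q₀ - P) * Pᵀ = 0 := by
    rw [h.sub_eq, h.eq_trunc, transpose_mul, transpose_mul, diagonal_transpose,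
      transpose_transpose, mul_mul_mul_mul_cancel h.right, Matrix.mul_assoc U,
      ← Matrix.mul_assoc (diagonal _), diagonal_restrictTo_mul, Matrix.zero_mul, Matrix.mul_zero]
  have h2 := congrArg transpose h1
  rwa [transpose_mul, transpose_transpose, transpose_zero] at h2

theorem expansion (h : IsTruncation Q₀ P r U σ V I) :
    (fun Q => sqDist Q₀ Q - sqDist Q₀ P - hessForm (Q₀ - P) h.gInv (Q - P) (Q - P))
      =o[𝓝[detVariety dy dx r] P] fun Q => ‖Q - P‖ ^ 2 :=
  h.isGInv.expansion h.rank h.residual_transpose_mul h.mul_residual_transpose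

theorem isSmoothPoint (h : IsTruncation Q₀ P r U σ V I) : IsSmoothPoint (detVariety dy dx r) P :=
  h.isGInv.isSmoothPoint h.rank

theorem isCriticalOn (h : IsTruncation Q₀ P r U σ V I) :
    IsCriticalOn (sqDist Q₀) (detVariety dy dx r) P :=
  isCriticalOn_of_expansion h.isSmoothPoint h.expansion

/-- Matrices in the tangent space at the truncation are sums of directions of lines. -/
theorem mem_span (h : IsTruncation Q₀ P r U σ V I) {Z : Matrix (Fin m) (Fin m) ℝ}
    (hZ : ∀ x ∉ I, ∀ y ∉ I, Z x y = 0) : U * Z * Vᵀ ∈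
      Submodule.span ℝ {X : Matrix (Fin dy) (Fin dx) ℝ |
        ∀ t : ℝ, P + t • X ∈ detVariety dy dx r} := by
  set D := diagonal (restrictTo σ I) with hD
  set D' := diagonal (fun i => (restrictTo σ I i)⁻¹) with hD'
  -- `D' * D` is the projection onto the coordinates in `I`. The first term keeps the columns in
  -- `I`; the rest has, by `hZ`, only rows in `I`.
  have h1 : Z = Z * (D' * D) + (D * D') * (Z * (1 - D' * D)) := by
    rw [hD, hD', diagonal_mul_diagonal, diagonal_mul_diagonal]
    ext x y
    rw [Matrix.add_apply, diagonal_mul, mul_diagonal, Matrix.mul_sub, Matrix.sub_apply,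
      Matrix.mul_one, mul_diagonal]
    by_cases hy : y ∈ I
    · have := (h.pos y hy).ne'
      simp [restrictTo, hy, this]
    · by_cases hx : x ∈ I
      · have := (h.pos x hx).ne'
        simp [restrictTo, hx, hy, this]
      · simp [restrictTo, hx, hy, hZ x hx y hy]
  have h2 : U * Z * Vᵀ = (U * (Z * D') * Uᵀ) * P + P * (V * (D' * (Z * (1 - D' * D))) * Vᵀ) := by
    rw [h.eq_trunc, ← hD, Matrix.mul_assoc U D, mul_mul_mul_mul_cancel h.left, Matrix.mul_assoc V,
      ← Matrix.mul_assoc U D, mul_mul_mul_mul_cancel h.right]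
    conv_lhs => rw [h1]
    rw [Matrix.mul_add, Matrix.add_mul]
    simp only [Matrix.mul_assoc]
  rw [h2]
  exact Submodule.add_mem _ (Submodule.subset_span (line_mul_left_mem h.mem _))
    (Submodule.subset_span (line_mul_right_mem h.mem _))

/-- Doubling symmetrizes the sum over index pairs, so each summand involves only the block of `Y x
y` and `Y y x`. The term `‖X‖² - ‖Uᵀ X V‖²` is the part of `X` outside the singular subspaces. -/
theorem two_mul_hessForm (h : IsTruncation Q₀ P r U σ V I) (X : Matrix (Fin dy) (Fin dx) ℝ) :
    2 * hessForm (Q₀ - P) h.gInv X X = 2 * (‖X‖ ^ 2 - ‖Uᵀ * X * V‖ ^ 2) +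
      ∑ x, ∑ y, ((Uᵀ * X * V) x y ^ 2 + (Uᵀ * X * V) y x ^ 2 -
        2 * (restrictTo σ Iᶜ x * (restrictTo σ I y)⁻¹ + restrictTo σ Iᶜ y * (restrictTo σ I x)⁻¹) *
          ((Uᵀ * X * V) x y * (Uᵀ * X * V) y x)) := by
  have h1 := hessForm_diagonal_conj (U := U) (V := V) (restrictTo σ Iᶜ)
    (fun i => (restrictTo σ I i)⁻¹) X
  rw [← h.sub_eq] at h1
  rw [gInv, h1]
  set Y := Uᵀ * X * V
  have h2 : ‖Y‖ ^ 2 = ∑ x, ∑ y, Y y x ^ 2 := by rw [norm_sq_eq_sum, Finset.sum_comm]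
  have h3 : ∑ a, ∑ j, restrictTo σ Iᶜ a * (restrictTo σ I j)⁻¹ * (Y a j * Y j a) =
      ∑ x, ∑ y, restrictTo σ Iᶜ y * (restrictTo σ I x)⁻¹ * (Y x y * Y y x) := by
    rw [Finset.sum_comm]
    exact Finset.sum_congr rfl fun x _ => Finset.sum_congr rfl fun y _ => by ring
  have h4 : ∑ x, ∑ y, (Y x y ^ 2 + Y y x ^ 2 -
        2 * (restrictTo σ Iᶜ x * (restrictTo σ I y)⁻¹ + restrictTo σ Iᶜ y * (restrictTo σ I x)⁻¹) *
          (Y x y * Y y x)) = ‖Y‖ ^ 2 + ‖Y‖ ^ 2 - 4 *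
      ∑ a, ∑ j, restrictTo σ Iᶜ a * (restrictTo σ I j)⁻¹ * (Y a j * Y j a) := by
    calc _ = ∑ x, ∑ y, Y x y ^ 2 + ∑ x, ∑ y, Y y x ^ 2 -
          2 * ∑ x, ∑ y, restrictTo σ Iᶜ x * (restrictTo σ I y)⁻¹ * (Y x y * Y y x) -
          2 * ∑ x, ∑ y, restrictTo σ Iᶜ y * (restrictTo σ I x)⁻¹ * (Y x y * Y y x) := by
          simp only [Finset.mul_sum, ← Finset.sum_add_distrib, ← Finset.sum_sub_distrib]
          exact Finset.sum_congr rfl fun x _ => Finset.sum_congr rfl fun y _ => by ring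
      _ = _ := by rw [← h2, ← norm_sq_eq_sum, ← h3]; ring
  rw [h4]
  ring

/-- The pairs of a retained and a discarded index in the wrong order. -/
noncomputable def inversions (σ : Fin m → ℝ) (I : Finset (Fin m)) : Finset (Fin m × Fin m) :=
  (I ×ˢ (Finset.univ \ I)).filter fun p => σ p.1 < σ p.2

theorem mem_inversions {p : Fin m × Fin m} :
    p ∈ inversions σ I ↔ p.1 ∈ I ∧ p.2 ∉ I ∧ σ p.1 < σ p.2 := by
  simp [inversions, and_assoc]

/-- In the block of `x ∉ I`, `y ∈ I` put `c = σ x / σ y`, `a = Y x y`, `b = Y y x`. Without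
inversion `c ≤ 1`, and `a² + b² - 2cab = (1 - c)(a² + b²) + c(a - b)²`. At an inversion the
constraint gives `b = -a` and the block is `2(1 + c)a²`. -/
theorem hessForm_nonneg (h : IsTruncation Q₀ P r U σ V I) {X : Matrix (Fin dy) (Fin dx) ℝ}
    (hX : ∀ p ∈ inversions σ I, (Uᵀ * X * V) p.2 p.1 + (Uᵀ * X * V) p.1 p.2 = 0) :
    0 ≤ hessForm (Q₀ - P) h.gInv X X := by
  have h1 := h.two_mul_hessForm X
  have h2 := norm_conj_transpose_le h.left h.right X
  set Y := Uᵀ * X * V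
  have key : ∀ x y, x ∉ I → y ∈ I →
      0 ≤ Y x y ^ 2 + Y y x ^ 2 - 2 * (σ x * (σ y)⁻¹) * (Y x y * Y y x) := by
    intro x y hx hy
    have hy0 := h.pos y hy
    have hc : 0 ≤ σ x * (σ y)⁻¹ := mul_nonneg (h.nonneg x) (inv_nonneg.2 hy0.le)
    by_cases hlt : σ y < σ x
    · have h3 := hX (y, x) (mem_inversions.2 ⟨hy, hx, hlt⟩)
      have h4 : Y y x = -Y x y := by simp only at h3; linarith
      rw [h4]
      nlinarith [mul_nonneg hc (sq_nonneg (Y x y)), sq_nonneg (Y x y)]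
    · have hc1 : σ x * (σ y)⁻¹ ≤ 1 := by
        rw [← div_eq_mul_inv, div_le_one hy0]; exact not_lt.1 hlt
      nlinarith [mul_nonneg hc (sq_nonneg (Y x y - Y y x)),
        mul_nonneg (sub_nonneg.2 hc1) (add_nonneg (sq_nonneg (Y x y)) (sq_nonneg (Y y x)))]
  have h3 : 0 ≤ ∑ x, ∑ y, (Y x y ^ 2 + Y y x ^ 2 -
        2 * (restrictTo σ Iᶜ x * (restrictTo σ I y)⁻¹ + restrictTo σ Iᶜ y * (restrictTo σ I x)⁻¹) *
          (Y x y * Y y x)) := by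
    refine Finset.sum_nonneg fun x _ => Finset.sum_nonneg fun y _ => ?_
    by_cases hx : x ∈ I <;> by_cases hy : y ∈ I
    · simp only [restrictTo, hx, hy, Finset.mem_compl, not_true, if_false, if_true]
      nlinarith [sq_nonneg (Y x y), sq_nonneg (Y y x)]
    · simp only [restrictTo, hx, hy, Finset.mem_compl, not_true, not_false_iff, if_false, if_true]
      have := key y x hy hx
      simp only [_root_.inv_zero, mul_zero, zero_add]
      linarith
    · simp only [restrictTo, hx, hy, Finset.mem_compl, not_true, not_false_iff, if_false, if_true]
      have := key x y hx hy
      simp only [_root_.inv_zero, mul_zero, add_zero]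
      linarith
    · simp only [restrictTo, hx, hy, Finset.mem_compl, not_false_iff, if_false, if_true]
      simp only [_root_.inv_zero, mul_zero, add_zero, zero_mul, sub_zero]
      positivity
  linarith

/-- The symmetric matrix with prescribed entries at the inversions and zeros elsewhere. -/
noncomputable def inversionMatrix (σ : Fin m → ℝ) (I : Finset (Fin m)) :
    (inversions σ I → ℝ) →ₗ[ℝ] Matrix (Fin m) (Fin m) ℝ where
  toFun c := of fun x y => (if hp : (y, x) ∈ inversions σ I then c ⟨_, hp⟩ else 0) +
    if hp : (x, y) ∈ inversions σ I then c ⟨_, hp⟩ else 0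
  map_add' c c' := by
    ext x y
    simp only [of_apply, Matrix.add_apply]
    split_ifs <;> (simp; try ring)
  map_smul' k c := by
    ext x y
    simp only [of_apply, Matrix.smul_apply, RingHom.id_apply]
    split_ifs <;> (simp; try ring)

theorem inversionMatrix_apply (c : inversions σ I → ℝ) (x y : Fin m) : inversionMatrix σ I c x y =
    (if hp : (y, x) ∈ inversions σ I then c ⟨_, hp⟩ else 0) +
    if hp : (x, y) ∈ inversions σ I then c ⟨_, hp⟩ else 0 := rfl

theorem inversionMatrix_symm (c : inversions σ I → ℝ) (x y : Fin m) :
    inversionMatrix σ I c y x = inversionMatrix σ I c x y := by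
  rw [inversionMatrix_apply, inversionMatrix_apply, add_comm]

theorem inversionMatrix_apply_inversion (c : inversions σ I → ℝ) (p : inversions σ I) :
    inversionMatrix σ I c p.1.1 p.1.2 = c p := by
  have h1 : (p.1.2, p.1.1) ∉ inversions σ I := fun h =>
    (mem_inversions.1 p.2).2.1 (mem_inversions.1 h).1
  rw [inversionMatrix_apply, dif_neg h1, zero_add]
  simp

/-- The symmetric direction `a = b` is the eigenvector of a block with eigenvalue `1 - c`, and `c >
1` exactly at an inversion. -/
theorem hessForm_inversionMatrix_neg (h : IsTruncation Q₀ P r U σ V I) {c : inversions σ I → ℝ}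
    (hc : c ≠ 0) : hessForm (Q₀ - P) h.gInv (U * inversionMatrix σ I c * Vᵀ)
      (U * inversionMatrix σ I c * Vᵀ) < 0 := by
  have h1 := h.two_mul_hessForm (U * inversionMatrix σ I c * Vᵀ)
  rw [conj_conj h.left h.right, norm_conj h.left h.right, sub_self, mul_zero, zero_add] at h1
  set Z := inversionMatrix σ I c with hZ
  set w : Fin m → Fin m → ℝ := fun x y =>
    restrictTo σ Iᶜ x * (restrictTo σ I y)⁻¹ + restrictTo σ Iᶜ y * (restrictTo σ I x)⁻¹ with hw
  have h2 : ∀ x y, Z x y ^ 2 + Z y x ^ 2 - 2 * (restrictTo σ Iᶜ x * (restrictTo σ I y)⁻¹ +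
      restrictTo σ Iᶜ y * (restrictTo σ I x)⁻¹) * (Z x y * Z y x) =
      2 * ((1 - w x y) * Z x y ^ 2) := fun x y => by
    rw [hZ, inversionMatrix_symm]; ring
  simp only [h2] at h1
  have hw1 : ∀ x y, (x, y) ∈ inversions σ I → 1 < w x y := by
    intro x y hp
    obtain ⟨hx, hy, hlt⟩ := mem_inversions.1 hp
    simp only at hx hy hlt
    simp only [hw, restrictTo, hx, hy, Finset.mem_compl, not_true, not_false_iff, if_false, if_true,
      _root_.inv_zero, mul_zero, zero_add]
    rwa [← div_eq_mul_inv, one_lt_div (h.pos x hx)]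
  have hle : ∀ x y, 2 * ((1 - w x y) * Z x y ^ 2) ≤ 0 := by
    intro x y
    by_cases hp : (x, y) ∈ inversions σ I
    · nlinarith [mul_nonneg (sub_nonneg.2 (hw1 x y hp).le) (sq_nonneg (Z x y))]
    · by_cases hp' : (y, x) ∈ inversions σ I
      · have h3 : 1 < w x y := by
          have := hw1 y x hp'
          simp only [hw] at this ⊢
          linarith
        nlinarith [mul_nonneg (sub_nonneg.2 h3.le) (sq_nonneg (Z x y))]
      · have : Z x y = 0 := by rw [hZ, inversionMatrix_apply, dif_neg hp, dif_neg hp', add_zero]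
        simp [this]
  obtain ⟨p, hp⟩ := Function.ne_iff.1 hc
  have hlt : 2 * ((1 - w p.1.1 p.1.2) * Z p.1.1 p.1.2 ^ 2) < 0 := by
    rw [hZ, inversionMatrix_apply_inversion]
    have h3 := hw1 p.1.1 p.1.2 p.2
    have h4 : 0 < c p ^ 2 := by have : c p ≠ 0 := hp; positivity
    nlinarith
  have hsum : ∑ x, ∑ y, 2 * ((1 - w x y) * Z x y ^ 2) < 0 := by
    refine Finset.sum_neg' (fun x _ => Finset.sum_nonpos fun y _ => hle x y)
      ⟨p.1.1, Finset.mem_univ _, ?_⟩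
    exact Finset.sum_neg' (fun y _ => hle _ y) ⟨p.1.2, Finset.mem_univ _, hlt⟩
  linarith

theorem inversionMatrix_mem_span (h : IsTruncation Q₀ P r U σ V I) (c : inversions σ I → ℝ) :
    U * inversionMatrix σ I c * Vᵀ ∈ Submodule.span ℝ {X : Matrix (Fin dy) (Fin dx) ℝ |
        ∀ t : ℝ, P + t • X ∈ detVariety dy dx r} := by
  refine h.mem_span fun x hx y hy => ?_
  have h1 : (x, y) ∉ inversions σ I := fun hp => hx (mem_inversions.1 hp).1
  have h2 : (y, x) ∉ inversions σ I := fun hp => hy (mem_inversions.1 hp).1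
  rw [inversionMatrix_apply, dif_neg h1, dif_neg h2, add_zero]

/-- The Morse index of a truncation is the number of its inversions. -/
theorem hasMorseIndex (h : IsTruncation Q₀ P r U σ V I) :
    HasMorseIndex (sqDist Q₀) (detVariety dy dx r) P (inversions σ I).card := by
  rw [← Fintype.card_coe]
  let W : (inversions σ I → ℝ) →ₗ[ℝ] Matrix (Fin dy) (Fin dx) ℝ :=
    mulRightLinearMap (Fin dy) ℝ Vᵀ ∘ₗ mulLeftLinearMap (Fin m) ℝ U ∘ₗ inversionMatrix σ I
  -- The kernel of `Λ` consists of the directions that are antisymmetric at every inversion.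
  let Λ : Matrix (Fin dy) (Fin dx) ℝ →ₗ[ℝ] (inversions σ I → ℝ) :=
    LinearMap.pi fun p => (entryLinearMap ℝ ℝ p.1.2 p.1.1 + entryLinearMap ℝ ℝ p.1.1 p.1.2) ∘ₗ
      mulRightLinearMap (Fin m) ℝ V ∘ₗ mulLeftLinearMap (Fin dx) ℝ Uᵀ
  refine hasMorseIndex_of_expansion contDiff_sqDist.contDiffAt h.isCriticalOn h.expansion W Λ
    h.inversionMatrix_mem_span (fun c hc => h.hessForm_inversionMatrix_neg hc) fun X hX => ?_
  exact h.hessForm_nonneg fun p hp => congrFun hX ⟨p, hp⟩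

/-- At a local minimum, every retained singular value dominates every discarded one. -/
theorem le_of_isLocalMinOn (h : IsTruncation Q₀ P r U σ V I)
    (hmin : IsLocalMinOn (sqDist Q₀) (detVariety dy dx r) P) :
    ∀ j ∈ I, ∀ a ∉ I, σ a ≤ σ j := by
  intro j hj a ha
  by_contra hlt
  push Not at hlt
  let p : inversions σ I := ⟨(j, a), mem_inversions.2 ⟨hj, ha, hlt⟩⟩
  have hc : (fun _ => 1 : inversions σ I → ℝ) ≠ 0 := Function.ne_iff.2 ⟨p, one_ne_zero⟩
  have h1 := nonneg_of_isLocalMinOn h.isSmoothPoint hmin h.expansion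
    (h.inversionMatrix_mem_span fun _ => 1)
  exact absurd (h.hessForm_inversionMatrix_neg hc) (not_lt.2 h1)

end IsTruncation

end DiagonalForm

/-! ### The Eckart-Young lower bound -/

section GlobalMinimum

variable {dy dx m r : ℕ}

theorem gram_eq_one_of_orthonormal {J : Type*} {c : ℕ} {u : J → EuclideanSpace ℝ (Fin dy)}
    (hu : Orthonormal ℝ u) {e : Fin c → J} (he : Function.Injective e) :
    (of fun i k => u (e k) i : Matrix (Fin dy) (Fin c) ℝ)ᵀ *
      (of fun i k => u (e k) i : Matrix (Fin dy) (Fin c) ℝ) = 1 := by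
  ext i j
  have h1 := orthonormal_iff_ite.1 (hu.comp e he) j i
  rw [EuclideanSpace.inner_eq_star_dotProduct, star_trivial] at h1
  rw [one_apply]
  simp only [eq_comm] at h1
  rw [h1]
  rfl

/-- The thin singular value decomposition, in matrix form. -/
theorem exists_thin_svd_matrix (A : Matrix (Fin dy) (Fin dx) ℝ) :
    ∃ (c : ℕ) (W : Matrix (Fin dy) (Fin c) ℝ) (Z : Matrix (Fin dx) (Fin c) ℝ)
      (s : Fin c → ℝ), A.rank = c ∧ Wᵀ * W = 1 ∧ Zᵀ * Z = 1 ∧ (∀ k, 0 < s k) ∧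
      A = W * diagonal s * Zᵀ := by
  obtain ⟨J, _, u, v, s, hu, hv, hs, -, -, hA⟩ := exists_thin_svd A
  let e := (Fintype.equivFin J).symm
  have hW := gram_eq_one_of_orthonormal hu e.injective
  have hZ := gram_eq_one_of_orthonormal hv e.injective
  set W : Matrix (Fin dy) (Fin (Fintype.card J)) ℝ := of fun i k => u (e k) i
  set Z : Matrix (Fin dx) (Fin (Fintype.card J)) ℝ := of fun i k => v (e k) i
  have hA' : A = W * diagonal (s ∘ e) * Zᵀ := by
    rw [mul_diagonal_mul_eq_sum]
    conv_lhs => rw [hA, ← Equiv.sum_comp e]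
    rfl
  have hr : A.rank = Fintype.card J := by
    conv_lhs => rw [hA', rank_diagonal_conj hW hZ]
    rw [Finset.filter_true_of_mem fun i _ => ne_of_gt (show 0 < (s ∘ e) i from hs (e i)),
      Finset.card_univ, Fintype.card_fin]
  exact ⟨_, W, Z, s ∘ e, hr, hW, hZ, fun k => hs _, hA'⟩

theorem card_firstIdx (hr : r ≤ m) : (firstIdx m r).card = r := by
  rw [firstIdx, Fin.card_filter_val_lt]; omega

theorem mem_firstIdx {i : Fin m} : i ∈ firstIdx m r ↔ i.val < r := by simp [firstIdx]

/-- Subtract the threshold `τ = w r`, which (counting from `0`) is the first weight outside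
`firstIdx m r`. The terms `p i * (w i - τ)` then compare one by one, and `∑ p ≤ r` with `τ ≥ 0`
absorbs the threshold. -/
theorem sum_mul_le_sum_firstIdx {w p : Fin m → ℝ} (hw : Antitone w) (hw0 : ∀ i, 0 ≤ w i)
    (hr : r < m) (hp0 : ∀ i, 0 ≤ p i) (hp1 : ∀ i, p i ≤ 1) (hp : ∑ i, p i ≤ r) :
    ∑ i, p i * w i ≤ ∑ i ∈ firstIdx m r, w i := by
  set τ := w ⟨r, hr⟩
  have h1 : ∀ i, p i * (w i - τ) ≤ if i ∈ firstIdx m r then w i - τ else 0 := by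
    intro i
    split_ifs with hi
    · have : τ ≤ w i := hw (Fin.le_def.2 (mem_firstIdx.1 hi).le)
      exact mul_le_of_le_one_left (by linarith) (hp1 i)
    · have : w i ≤ τ := hw (Fin.le_def.2 (not_lt.1 fun h => hi (mem_firstIdx.2 h)))
      exact mul_nonpos_of_nonneg_of_nonpos (hp0 i) (by linarith)
  have h2 := Finset.sum_le_sum fun i (_ : i ∈ Finset.univ) => h1 i
  rw [Finset.sum_ite_mem, Finset.univ_inter, Finset.sum_sub_distrib, Finset.sum_const,
    card_firstIdx hr.le, nsmul_eq_mul] at h2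
  simp only [mul_sub, Finset.sum_sub_distrib, ← Finset.sum_mul] at h2
  nlinarith [mul_le_mul_of_nonneg_right hp (hw0 ⟨r, hr⟩)]

/-- The Eckart-Young lower bound for a diagonal matrix. -/
theorem sum_compl_firstIdx_le {σ : Fin m → ℝ} (hσ : Antitone σ) (hσ0 : ∀ i, 0 ≤ σ i) (hr : r < m)
    {N : Matrix (Fin m) (Fin m) ℝ} (hN : N.rank ≤ r) :
    ∑ i, σ i ^ 2 - ∑ i ∈ firstIdx m r, σ i ^ 2 ≤ ‖N - diagonal σ‖ ^ 2 := by
  obtain ⟨c, W, Z, s, hc, hW, -, -, hN'⟩ := exists_thin_svd_matrix N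
  have h1 : W * (Wᵀ * N) = N := by
    conv_lhs => rw [hN', Matrix.mul_assoc W, ← Matrix.mul_assoc Wᵀ, hW, Matrix.one_mul]
    rw [← Matrix.mul_assoc, ← hN']
  -- Since `W * Wᵀ` fixes `N`, the difference of the two sides is `‖Wᵀ * N - Wᵀ * diagonal σ‖ ^ 2`.
  have h2 : ‖diagonal σ‖ ^ 2 - ‖Wᵀ * diagonal σ‖ ^ 2 ≤ ‖N - diagonal σ‖ ^ 2 := by
    have h3 := norm_sub_sq_eq N (diagonal σ)
    have h4 := norm_sub_sq_eq (Wᵀ * N) (Wᵀ * diagonal σ)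
    have h5 : ‖Wᵀ * N‖ ^ 2 = ‖N‖ ^ 2 := by
      conv_rhs => rw [norm_sq_eq_trace, ← h1, transpose_mul, mul_mul_mul_mul_cancel hW]
      rw [norm_sq_eq_trace]
    have h6 : trace ((Wᵀ * diagonal σ)ᵀ * (Wᵀ * N)) = trace ((diagonal σ)ᵀ * N) := by
      rw [transpose_mul, transpose_transpose, Matrix.mul_assoc, h1]
    rw [h5, h6] at h4
    linarith [sq_nonneg ‖Wᵀ * N - Wᵀ * diagonal σ‖]
  have h3 : ‖diagonal σ‖ ^ 2 = ∑ i, σ i ^ 2 := by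
    rw [norm_sq_eq_sum]
    refine Finset.sum_congr rfl fun i _ => ?_
    rw [Finset.sum_eq_single i (fun j _ hj => by simp [diagonal_apply_ne' _ hj]) (by simp)]
    simp
  have h4 : ‖Wᵀ * diagonal σ‖ ^ 2 = ∑ i, (∑ k, W i k ^ 2) * σ i ^ 2 := by
    rw [norm_sq_eq_sum, Finset.sum_comm]
    refine Finset.sum_congr rfl fun i _ => ?_
    rw [Finset.sum_mul]
    refine Finset.sum_congr rfl fun k _ => ?_
    rw [mul_diagonal, transpose_apply, mul_pow]
  have h5 : ∑ i, (∑ k, W i k ^ 2) * σ i ^ 2 ≤ ∑ i ∈ firstIdx m r, σ i ^ 2 := by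
    refine sum_mul_le_sum_firstIdx (fun i j hij => pow_le_pow_left₀ (hσ0 j) (hσ hij) 2)
      (fun i => sq_nonneg _) hr (fun i => Finset.sum_nonneg fun k _ => sq_nonneg _) (fun i => ?_) ?_
    -- Applied to the `i`-th basis vector, this bounds the squared length of the `i`-th row of `W`
    -- by `1`. The sum of all these weights is `c = N.rank`.
    · have h6 := norm_transpose_mul_le hW (of fun j (_ : Fin 1) => if j = i then (1 : ℝ) else 0)
      rw [norm_sq_eq_sum, norm_sq_eq_sum] at h6
      simpa [ite_pow, mul_apply] using h6
    · rw [← norm_sq_eq_sum, norm_sq_eq_trace, hW, trace_one, Fintype.card_fin]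
      exact_mod_cast hc ▸ hN
  rw [h3, h4] at h2
  linarith

variable {U : Matrix (Fin dy) (Fin m) ℝ} {V : Matrix (Fin dx) (Fin m) ℝ} {σ : Fin m → ℝ}
  {Q₀ P : Matrix (Fin dy) (Fin dx) ℝ}

/-- The **Eckart-Young theorem**: truncation to the largest singular values is a global minimum. -/
theorem IsTruncation.isMinOn (h : IsTruncation Q₀ P r U σ V (firstIdx m r)) (hσ : Antitone σ)
    (hr : r < m) : IsMinOn (sqDist Q₀) (detVariety dy dx r) P := by
  intro Q hQ
  have h1 : sqDist Q₀ P = ∑ i, σ i ^ 2 - ∑ i ∈ firstIdx m r, σ i ^ 2 := by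
    rw [sqDist, norm_sub_rev, h.sub_eq, norm_conj h.left h.right, norm_sq_eq_sum,
      eq_sub_iff_add_eq]
    have h2 : ∀ i, ∑ j, diagonal (restrictTo σ (firstIdx m r)ᶜ) i j ^ 2 =
        if i ∈ firstIdx m r then 0 else σ i ^ 2 := fun i => by
      rw [Finset.sum_eq_single i (fun j _ hj => by simp [diagonal_apply_ne' _ hj]) (by simp)]
      by_cases hi : i ∈ firstIdx m r <;> simp [restrictTo, hi]
    simp only [h2]
    rw [← Finset.univ_inter (firstIdx m r), ← Finset.sum_ite_mem, ← Finset.sum_add_distrib]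
    refine Finset.sum_congr rfl fun i _ => ?_
    by_cases hi : i ∈ firstIdx m r <;> simp [hi]
  -- Compression by `U` and `V` increases neither the rank nor the distance, which reduces the bound
  -- to diagonal matrices.
  have hN : (Uᵀ * Q * V).rank ≤ r :=
    (rank_mul_le_left _ _).trans ((rank_mul_le_right _ _).trans hQ)
  have h2 := sum_compl_firstIdx_le hσ h.nonneg hr hN
  have h3 : Uᵀ * Q * V - diagonal σ = Uᵀ * (Q - Q₀) * V := by
    rw [Matrix.mul_sub, Matrix.sub_mul, h.eq, conj_conj h.left h.right]
  rw [h3] at h2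
  change sqDist Q₀ P ≤ sqDist Q₀ Q
  rw [h1, sqDist]
  exact h2.trans (norm_conj_transpose_le h.left h.right _)

end GlobalMinimum

/-! ### From orthogonality of the residual to truncated decompositions -/

section Stationary

variable {dy dx r : ℕ} {Q₀ P : Matrix (Fin dy) (Fin dx) ℝ}

theorem IsSVD.isTruncation {U : Matrix (Fin dy) (Fin dy) ℝ} {σ : Fin (min dy dx) → ℝ}
    {V : Matrix (Fin dx) (Fin dx) ℝ} (h : IsSVD Q₀ U σ V) {I : Finset (Fin (min dy dx))}
    (hI : I.card = r) (hpos : ∀ i ∈ I, 0 < σ i) :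
    IsTruncation Q₀ (U * rectDiagOn σ I * Vᵀ) r (leftCols dx U) σ (rightCols dy V) I where
  left := leftCols_orthonormal h.left_orthogonal
  right := rightCols_orthonormal h.right_orthogonal
  nonneg := h.nonneg
  pos := hpos
  card := hI
  eq := by rw [h.eq_mul, mul_rectDiag_mul]
  eq_trunc := by rw [rectDiagOn, mul_rectDiag_mul]; rfl

theorem lt_min_of_notMem (hQ₀ : Q₀ ∉ detVariety dy dx r) : r < min dy dx := by
  have h1 : r < Q₀.rank := not_le.1 hQ₀
  have h2 := Q₀.rank_le_height
  have h3 := Q₀.rank_le_width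
  omega

/-- A zero among the first `r` singular values would confine all nonzero ones to `firstIdx`, so that
`Q₀` would have rank at most `r`. -/
theorem IsSVD.pos_of_mem_firstIdx (hQ₀ : Q₀ ∉ detVariety dy dx r)
    {U : Matrix (Fin dy) (Fin dy) ℝ} {σ : Fin (min dy dx) → ℝ} {V : Matrix (Fin dx) (Fin dx) ℝ}
    (h : IsSVD Q₀ U σ V) : ∀ i ∈ firstIdx (min dy dx) r, 0 < σ i := by
  intro i hi
  refine lt_of_le_of_ne (h.nonneg i) fun h0 => hQ₀ ?_
  change Q₀.rank ≤ r
  rw [h.eq_mul, mul_rectDiag_mul, rank_diagonal_conj (leftCols_orthonormal h.left_orthogonal)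
    (rightCols_orthonormal h.right_orthogonal), ← card_firstIdx (lt_min_of_notMem hQ₀).le]
  refine Finset.card_le_card fun k hk => ?_
  by_contra hk'
  have h1 : i ≤ k := by
    rw [mem_firstIdx] at hi hk'
    exact Fin.le_def.2 (by omega)
  have h2 := h.antitone h1
  rw [← h0] at h2
  exact (Finset.mem_filter.1 hk).2 (le_antisymm h2 (h.nonneg k))

/-- A matrix whose row and column spaces are orthogonal to those of the residual is a truncation
of a singular value decomposition. -/
theorem exists_svd_of_orthogonal (hr : P.rank = r) (hl : (Q₀ - P)ᵀ * P = 0)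
    (hrt : P * (Q₀ - P)ᵀ = 0) :
    ∃ (U : Matrix (Fin dy) (Fin dy) ℝ) (σ : Fin (min dy dx) → ℝ)
      (V : Matrix (Fin dx) (Fin dx) ℝ) (I : Finset (Fin (min dy dx))),
      IsSVD Q₀ U σ V ∧ I.card = r ∧ (∀ i ∈ I, 0 < σ i) ∧ P = U * rectDiagOn σ I * Vᵀ := by
  obtain ⟨J, _, u, v, s, hu, hv, hs, hPv, hPu, hP⟩ := exists_thin_svd P
  obtain ⟨K, _, u', v', t, hu', hv', ht, hRv, hRu, hR⟩ := exists_thin_svd (Q₀ - P)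
  have huu : ∀ j k, (u' k).ofLp ⬝ᵥ (u j).ofLp = 0 := fun j k => by
    have h1 : (t k • (u' k).ofLp) ⬝ᵥ (s j • (u j).ofLp) = 0 := by
      rw [← hRv, ← hPv, dotProduct_mulVec, vecMul_mulVec, hl, vecMul_zero, zero_dotProduct]
    rw [smul_dotProduct, dotProduct_smul, smul_smul, smul_eq_mul] at h1
    exact (mul_eq_zero.1 h1).resolve_left (mul_pos (ht k) (hs j)).ne'
  have hvv : ∀ j k, (v j).ofLp ⬝ᵥ (v' k).ofLp = 0 := fun j k => by
    have h1 : (s j • (v j).ofLp) ⬝ᵥ (t k • (v' k).ofLp) = 0 := by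
      rw [← hRu, ← hPu, dotProduct_mulVec, vecMul_mulVec, transpose_transpose, hrt, vecMul_zero,
        zero_dotProduct]
    rw [smul_dotProduct, dotProduct_smul, smul_smul, smul_eq_mul] at h1
    exact (mul_eq_zero.1 h1).resolve_left (mul_pos (hs j) (ht k)).ne'
  have hon : ∀ {d : ℕ} {a : J → EuclideanSpace ℝ (Fin d)} {b : K → EuclideanSpace ℝ (Fin d)},
      Orthonormal ℝ a → Orthonormal ℝ b → (∀ j k, (a j).ofLp ⬝ᵥ (b k).ofLp = 0) →
      Orthonormal ℝ (Sum.elim a b) := by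
    intro d a b ha hb hab
    refine ⟨?_, ?_⟩
    · rintro (j | k)
      · exact ha.1 j
      · exact hb.1 k
    · rintro (j | k) (j' | k') hne
      · exact ha.2 fun h => hne (by rw [h])
      · change inner ℝ (a j) (b k') = 0
        rw [EuclideanSpace.inner_eq_star_dotProduct, star_trivial, dotProduct_comm, hab]
      · change inner ℝ (b k) (a j') = 0
        rw [EuclideanSpace.inner_eq_star_dotProduct, star_trivial, hab]
      · exact hb.2 fun h => hne (by rw [h])
  have hU := hon hu hu' fun j k => by rw [dotProduct_comm, huu]
  have hV := hon hv hv' hvv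
  have hst : ∀ i, 0 < Sum.elim s t i := by
    rintro (j | k)
    · exact hs j
    · exact ht k
  -- `Q₀ = P + (Q₀ - P)` is decomposed by the two orthonormal families together; the indices coming
  -- from `P` form the set to be retained.
  obtain ⟨U, σ, V, I, hsvd, -, hpos, hA⟩ := exists_svd_of_family hU hV (fun i => (hst i).le)
    (Finset.univ.map Function.Embedding.inl)
  have hPA : P = U * rectDiagOn σ I * Vᵀ := by
    rw [← hA, Finset.sum_map]
    exact hP
  have hQ : Q₀ = ∑ i, Sum.elim s t i • vecMulVec (Sum.elim u u' i).ofLp (Sum.elim v v' i).ofLp := by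
    rw [Fintype.sum_sum_type]
    simp only [Sum.elim_inl, Sum.elim_inr]
    rw [← hP, ← hR, add_sub_cancel]
  rw [← hQ] at hsvd
  have hpos' : ∀ i ∈ I, 0 < σ i := fun i hi => by
    obtain ⟨j, -, hj⟩ := hpos i hi
    rw [hj]
    exact hst j
  refine ⟨U, σ, V, I, hsvd, ?_, hpos', hPA⟩
  rw [← hr, hPA, (hsvd.isTruncation rfl hpos').rank]

/-- Among the truncations dominated by the retained singular values, ties can be resolved. -/
theorem exists_svd_firstIdx_of_le {U : Matrix (Fin dy) (Fin dy) ℝ} {σ : Fin (min dy dx) → ℝ}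
    {V : Matrix (Fin dx) (Fin dx) ℝ} (h : IsSVD Q₀ U σ V) {I : Finset (Fin (min dy dx))}
    (hI : I.card = r) (hle : ∀ j ∈ I, ∀ a ∉ I, σ a ≤ σ j) :
    ∃ (U' : Matrix (Fin dy) (Fin dy) ℝ) (σ' : Fin (min dy dx) → ℝ)
      (V' : Matrix (Fin dx) (Fin dx) ℝ), IsSVD Q₀ U' σ' V' ∧
      U * rectDiagOn σ I * Vᵀ = U' * rectDiagOn σ' (firstIdx (min dy dx) r) * V'ᵀ := by
  have hon : ∀ {d n : ℕ} {W : Matrix (Fin d) (Fin n) ℝ}, Wᵀ * W = 1 →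
      Orthonormal ℝ fun k => (WithLp.toLp 2 (W.col k) : EuclideanSpace ℝ (Fin d)) := by
    intro d n W hW
    rw [orthonormal_iff_ite]
    intro i j
    rw [EuclideanSpace.inner_eq_star_dotProduct, star_trivial, dotProduct_comm, ← one_apply, ← hW]
    rfl
  obtain ⟨U', σ', V', hsvd, hA⟩ := exists_svd_firstIdx
    (hon (leftCols_orthonormal (dx := dx) h.left_orthogonal))
    (hon (rightCols_orthonormal (dy := dy) h.right_orthogonal)) h.nonneg hle
  refine ⟨U', σ', V', ?_, ?_⟩
  · rwa [← mul_diagonal_mul_eq_sum, ← mul_rectDiag_mul, ← h.eq_mul] at hsvd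
  · rw [← hI, ← hA, rectDiagOn, mul_rectDiag_mul, mul_diagonal_mul_eq_sum]
    simp only [ite_smul, zero_smul]
    rw [Finset.sum_ite_mem, Finset.univ_inter]

/-- With distinct singular values, truncations of `Q₀` are truncations of any given
decomposition. -/
theorem exists_truncation_of_orthogonal {m : ℕ} {U : Matrix (Fin dy) (Fin m) ℝ} {σ : Fin m → ℝ}
    {V : Matrix (Fin dx) (Fin m) ℝ} (hU : Uᵀ * U = 1) (hV : Vᵀ * V = 1)
    (hσ : Function.Injective σ) (hσ0 : ∀ i, 0 < σ i) (hQ : Q₀ = U * diagonal σ * Vᵀ)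
    (hr : P.rank = r) (hl : (Q₀ - P)ᵀ * P = 0) (hrt : P * (Q₀ - P)ᵀ = 0) :
    ∃ I : Finset (Fin m), IsTruncation Q₀ P r U σ V I := by
  have h1 : Q₀ᵀ * P = Pᵀ * P := by
    rw [transpose_sub, Matrix.sub_mul, sub_eq_zero] at hl; exact hl
  have h2 : P * Q₀ᵀ = P * Pᵀ := by
    rw [transpose_sub, Matrix.mul_sub, sub_eq_zero] at hrt; exact hrt
  have h2' : Q₀ * Pᵀ = P * Pᵀ := by
    have := congrArg transpose h2
    simpa [transpose_mul] using this
  have hz : ∀ {a b c : ℕ} (A : Matrix (Fin a) (Fin b) ℝ) (B : Matrix (Fin b) (Fin c) ℝ),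
      A * (B * Bᵀ) = 0 → A * B = 0 := by
    intro a b c A B hAB
    have h3 : ‖(A * B)ᵀ‖ ^ 2 = 0 := by
      rw [norm_sq_eq_trace, transpose_transpose, transpose_mul, Matrix.mul_assoc,
        ← Matrix.mul_assoc B, ← Matrix.mul_assoc, hAB, Matrix.zero_mul, trace_zero]
    have h4 := norm_eq_zero.1 (pow_eq_zero_iff two_ne_zero |>.1 h3)
    rw [← transpose_transpose (A * B), h4, transpose_zero]
  -- `P * Pᵀ = Q₀ * Pᵀ` shows that the column space of `P` lies in that of `U`; likewise for rows
  -- and `V`. So `P` is determined by `p = Uᵀ * P * V`.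
  have hUP : U * (Uᵀ * P) = P := by
    have h3 : (U * Uᵀ - 1) * P = 0 := by
      refine hz _ _ ?_
      rw [← h2', hQ, Matrix.sub_mul, Matrix.one_mul, Matrix.mul_assoc U, Matrix.mul_assoc U,
        Matrix.mul_assoc U, ← Matrix.mul_assoc Uᵀ, hU, Matrix.one_mul, sub_self]
    rwa [Matrix.sub_mul, Matrix.one_mul, sub_eq_zero, Matrix.mul_assoc] at h3
  have hVP : V * (Vᵀ * Pᵀ) = Pᵀ := by
    have h3 : (V * Vᵀ - 1) * Pᵀ = 0 := by
      refine hz _ _ ?_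
      rw [transpose_transpose, ← h1, hQ, transpose_mul, Matrix.sub_mul, Matrix.one_mul,
        Matrix.mul_assoc V, Matrix.mul_assoc, transpose_transpose, ← Matrix.mul_assoc Vᵀ, hV,
        Matrix.one_mul, sub_self]
    rwa [Matrix.sub_mul, Matrix.one_mul, sub_eq_zero, Matrix.mul_assoc] at h3
  have hVP' : P * V * Vᵀ = P := by
    have := congrArg transpose hVP
    simpa [transpose_mul, Matrix.mul_assoc] using this
  set p := Uᵀ * P * V with hp
  have hPp : P = U * p * Vᵀ := by
    rw [hp, Matrix.mul_assoc Uᵀ, ← Matrix.mul_assoc U, Matrix.mul_assoc (U * Uᵀ), hVP',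
      Matrix.mul_assoc, hUP]
  have hs1 : diagonal σ * p = pᵀ * p := by
    have h3 : Vᵀ * (Q₀ᵀ * P) * V = Vᵀ * (Pᵀ * P) * V := by rw [h1]
    have h4 : Q₀ᵀ * P = V * (diagonal σ * p) * Vᵀ := by
      rw [hQ, hPp, transpose_mul, transpose_mul, transpose_transpose, diagonal_transpose,
        ← Matrix.mul_assoc V, Matrix.mul_assoc U, mul_mul_mul_mul_cancel hU]
      simp only [Matrix.mul_assoc]
    have h5 : Pᵀ * P = V * (pᵀ * p) * Vᵀ := by
      conv_lhs => rw [hPp, transpose_mul, transpose_mul, transpose_transpose,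
        ← Matrix.mul_assoc V, Matrix.mul_assoc U, mul_mul_mul_mul_cancel hU]
      simp only [Matrix.mul_assoc]
    rwa [h4, h5, conj_conj hV hV, conj_conj hV hV] at h3
  have hs2 : diagonal σ * pᵀ = p * pᵀ := by
    have h3 : Uᵀ * (Q₀ * Pᵀ) * U = Uᵀ * (P * Pᵀ) * U := by rw [h2']
    have h4 : Q₀ * Pᵀ = U * (diagonal σ * pᵀ) * Uᵀ := by
      rw [hQ, hPp, transpose_mul, transpose_mul, transpose_transpose, mul_mul_mul_mul_cancel hV]
      simp only [Matrix.mul_assoc]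
    have h5 : P * Pᵀ = U * (p * pᵀ) * Uᵀ := by
      conv_lhs => rw [hPp, transpose_mul, transpose_mul, transpose_transpose,
        mul_mul_mul_mul_cancel hV]
      simp only [Matrix.mul_assoc]
    rwa [h4, h5, conj_conj hU hU, conj_conj hU hU] at h3
  -- `pᵀ * p` and `p * pᵀ` are symmetric, hence so are `diagonal σ * p` and `diagonal σ * pᵀ`. The
  -- two relations combine to `(σ i² - σ j²) * p i j = 0`.
  have he1 : ∀ i j, σ i * p i j = σ j * p j i := by
    have h3 : (diagonal σ * p)ᵀ = diagonal σ * p := by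
      rw [hs1, transpose_mul, transpose_transpose]
    intro i j
    have := congrFun (congrFun h3 j) i
    simpa [diagonal_mul] using this
  have he2 : ∀ i j, σ i * p j i = σ j * p i j := by
    have h3 : (diagonal σ * pᵀ)ᵀ = diagonal σ * pᵀ := by
      rw [hs2, transpose_mul, transpose_transpose]
    intro i j
    have := congrFun (congrFun h3 j) i
    simpa [diagonal_mul] using this
  have hoff : ∀ i j, i ≠ j → p i j = 0 := by
    intro i j hij
    have h3 : (σ i - σ j) * ((σ i + σ j) * p i j) = 0 := by
      linear_combination σ i * he1 i j + σ j * he2 i j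
    have h4 : σ i - σ j ≠ 0 := sub_ne_zero.2 fun h => hij (hσ h)
    have h5 : σ i + σ j ≠ 0 := (add_pos (hσ0 i) (hσ0 j)).ne'
    exact (mul_eq_zero.1 ((mul_eq_zero.1 h3).resolve_left h4)).resolve_left h5
  have hpd : p = diagonal fun i => p i i := by
    ext i j
    by_cases hij : i = j
    · subst hij; simp
    · rw [diagonal_apply_ne _ hij, hoff i j hij]
  -- For diagonal `p`, `hs1` reads `σ i * p i i = p i i ^ 2`.
  have hdiag : ∀ i, p i i ≠ 0 → p i i = σ i := by
    intro i hi
    have h3 := congrFun (congrFun hs1 i) i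
    rw [diagonal_mul, hpd, diagonal_transpose, diagonal_mul_diagonal] at h3
    simp only [diagonal_apply_eq] at h3
    exact (mul_right_cancel₀ hi h3).symm
  classical
  let I : Finset (Fin m) := Finset.univ.filter fun i => p i i ≠ 0
  have hpI : p = diagonal (restrictTo σ I) := by
    conv_lhs => rw [hpd]
    congr 1
    funext i
    by_cases hi : p i i = 0
    · simp [restrictTo, I, hi]
    · simp [restrictTo, I, hdiag i hi]
  have hPI : P = U * diagonal (restrictTo σ I) * Vᵀ := by rw [← hpI, ← hPp]
  refine ⟨I, hU, hV, fun i => (hσ0 i).le, fun i _ => hσ0 i, ?_, hQ, hPI⟩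
  rw [← hr, hPI, rank_diagonal_conj hU hV, filter_restrictTo_ne_zero fun i _ => hσ0 i]

end Stationary

end EckartYoung

/-! ### Critical points, minima and Morse indices of the distance function -/

theorem mainTheorem3 (dy dx r : ℕ) (Q₀ : Matrix (Fin dy) (Fin dx) ℝ)
    (hQ₀ : Q₀ ∉ EckartYoung.detVariety dy dx r) :
    -- the critical points
    (∀ P : Matrix (Fin dy) (Fin dx) ℝ,
      EckartYoung.IsCriticalOn (EckartYoung.sqDist Q₀) (EckartYoung.detVariety dy dx r) P ↔
        ∃ (U : Matrix (Fin dy) (Fin dy) ℝ) (σ : Fin (min dy dx) → ℝ)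
          (V : Matrix (Fin dx) (Fin dx) ℝ) (I : Finset (Fin (min dy dx))),
          EckartYoung.IsSVD Q₀ U σ V ∧ I.card = r ∧ (∀ i ∈ I, 0 < σ i) ∧
            P = U * EckartYoung.rectDiagOn σ I * Vᵀ) ∧
    -- the local minima, which are all global
    (∀ P ∈ EckartYoung.detVariety dy dx r,
      (IsLocalMinOn (EckartYoung.sqDist Q₀) (EckartYoung.detVariety dy dx r) P ↔
        ∃ (U : Matrix (Fin dy) (Fin dy) ℝ) (σ : Fin (min dy dx) → ℝ)
          (V : Matrix (Fin dx) (Fin dx) ℝ),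
          EckartYoung.IsSVD Q₀ U σ V ∧
            P = U * EckartYoung.rectDiagOn σ (EckartYoung.firstIdx (min dy dx) r) * Vᵀ) ∧
      (IsLocalMinOn (EckartYoung.sqDist Q₀) (EckartYoung.detVariety dy dx r) P ↔
        IsMinOn (EckartYoung.sqDist Q₀) (EckartYoung.detVariety dy dx r) P)) ∧
    -- distinct positive singular values
    (∀ (U : Matrix (Fin dy) (Fin dy) ℝ) (σ : Fin (min dy dx) → ℝ)
      (V : Matrix (Fin dx) (Fin dx) ℝ),
      EckartYoung.IsSVD Q₀ U σ V → Function.Injective σ → (∀ i, 0 < σ i) →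
        -- the critical points are the matrices `U Σ_I Vᵀ`, and their number is `m.choose r`
        {P | EckartYoung.IsCriticalOn (EckartYoung.sqDist Q₀)
            (EckartYoung.detVariety dy dx r) P} =
          {P | ∃ I : Finset (Fin (min dy dx)), I.card = r ∧
            P = U * EckartYoung.rectDiagOn σ I * Vᵀ} ∧
        {P | EckartYoung.IsCriticalOn (EckartYoung.sqDist Q₀)
            (EckartYoung.detVariety dy dx r) P}.ncard = (min dy dx).choose r ∧
        -- the unique local minimum, which is also the unique global minimum
        (∀ P ∈ EckartYoung.detVariety dy dx r,
          (IsLocalMinOn (EckartYoung.sqDist Q₀) (EckartYoung.detVariety dy dx r) P ↔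
            P = U * EckartYoung.rectDiagOn σ (EckartYoung.firstIdx (min dy dx) r) * Vᵀ) ∧
          (IsMinOn (EckartYoung.sqDist Q₀) (EckartYoung.detVariety dy dx r) P ↔
            P = U * EckartYoung.rectDiagOn σ (EckartYoung.firstIdx (min dy dx) r) * Vᵀ)) ∧
        -- the Morse index
        (∀ I : Finset (Fin (min dy dx)), I.card = r →
          EckartYoung.HasMorseIndex (EckartYoung.sqDist Q₀) (EckartYoung.detVariety dy dx r)
            (U * EckartYoung.rectDiagOn σ I * Vᵀ)
            ((I ×ˢ (Finset.univ \ I)).filter fun p => p.2 < p.1).card)) := by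

  have hrm := EckartYoung.lt_min_of_notMem hQ₀
  have hcrit : ∀ P, EckartYoung.IsCriticalOn (EckartYoung.sqDist Q₀)
      (EckartYoung.detVariety dy dx r) P → P.rank = r ∧ (Q₀ - P)ᵀ * P = 0 ∧ P * (Q₀ - P)ᵀ = 0 := by
    intro P hP
    obtain ⟨_, _, hφ⟩ := hP.1
    exact EckartYoung.rank_eq_and_orthogonal_of_stationary hQ₀ hφ.mem
      fun X hX => EckartYoung.trace_eq_zero_of_isCriticalOn hP hX
  have hloc : ∀ P ∈ EckartYoung.detVariety dy dx r, IsLocalMinOn (EckartYoung.sqDist Q₀)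
      (EckartYoung.detVariety dy dx r) P →
        P.rank = r ∧ (Q₀ - P)ᵀ * P = 0 ∧ P * (Q₀ - P)ᵀ = 0 := by
    intro P hP hmin
    exact EckartYoung.rank_eq_and_orthogonal_of_stationary hQ₀ hP
      fun X hX => EckartYoung.trace_eq_zero_of_isLocalMinOn hmin hX
  have hglob : ∀ (U : Matrix (Fin dy) (Fin dy) ℝ) (σ : Fin (min dy dx) → ℝ)
      (V : Matrix (Fin dx) (Fin dx) ℝ), EckartYoung.IsSVD Q₀ U σ V →
      IsMinOn (EckartYoung.sqDist Q₀) (EckartYoung.detVariety dy dx r)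
        (U * EckartYoung.rectDiagOn σ (EckartYoung.firstIdx (min dy dx) r) * Vᵀ) :=
    fun U σ V h => (h.isTruncation (EckartYoung.card_firstIdx hrm.le)
      (h.pos_of_mem_firstIdx hQ₀)).isMinOn h.antitone hrm
  have hlocSVD : ∀ P ∈ EckartYoung.detVariety dy dx r, IsLocalMinOn (EckartYoung.sqDist Q₀)
      (EckartYoung.detVariety dy dx r) P → ∃ (U : Matrix (Fin dy) (Fin dy) ℝ)
        (σ : Fin (min dy dx) → ℝ) (V : Matrix (Fin dx) (Fin dx) ℝ), EckartYoung.IsSVD Q₀ U σ V ∧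
          P = U * EckartYoung.rectDiagOn σ (EckartYoung.firstIdx (min dy dx) r) * Vᵀ := by
    intro P hP hmin
    obtain ⟨hr, hl, hrt⟩ := hloc P hP hmin
    obtain ⟨U, σ, V, I, hsvd, hI, hpos, rfl⟩ := EckartYoung.exists_svd_of_orthogonal hr hl hrt
    exact EckartYoung.exists_svd_firstIdx_of_le hsvd hI
      ((hsvd.isTruncation hI hpos).le_of_isLocalMinOn hmin)
  refine ⟨fun P => ⟨fun hP => ?_, ?_⟩, fun P hP => ⟨⟨hlocSVD P hP, ?_⟩, ?_, fun h => h.localize⟩, ?_⟩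
  · obtain ⟨hr, hl, hrt⟩ := hcrit P hP
    exact EckartYoung.exists_svd_of_orthogonal hr hl hrt
  · rintro ⟨U, σ, V, I, hsvd, hI, hpos, rfl⟩
    exact (hsvd.isTruncation hI hpos).isCriticalOn
  · rintro ⟨U, σ, V, hsvd, rfl⟩
    exact (hglob U σ V hsvd).localize
  · intro hmin
    obtain ⟨U, σ, V, hsvd, rfl⟩ := hlocSVD P hP hmin
    exact hglob U σ V hsvd
  · intro U σ V hsvd hinj hpos
    have hanti : StrictAnti σ := hsvd.antitone.strictAnti_of_injective hinj
    have htr : ∀ I : Finset (Fin (min dy dx)), I.card = r → _ := fun I hI =>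
      hsvd.isTruncation hI fun i _ => hpos i
    have huniq : ∀ P : Matrix (Fin dy) (Fin dx) ℝ, P.rank = r → (Q₀ - P)ᵀ * P = 0 →
        P * (Q₀ - P)ᵀ = 0 → ∃ I : Finset (Fin (min dy dx)), I.card = r ∧
          P = U * EckartYoung.rectDiagOn σ I * Vᵀ := by
      intro P hr hl hrt
      have hQ := hsvd.eq_mul
      rw [EckartYoung.mul_rectDiag_mul] at hQ
      obtain ⟨I, hI⟩ := EckartYoung.exists_truncation_of_orthogonal
        (EckartYoung.leftCols_orthonormal hsvd.left_orthogonal)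
        (EckartYoung.rightCols_orthonormal hsvd.right_orthogonal) hinj hpos hQ hr hl hrt
      exact ⟨I, hI.card, hI.eq_trunc.trans (htr I hI.card).eq_trunc.symm⟩
    have hset : {P | EckartYoung.IsCriticalOn (EckartYoung.sqDist Q₀)
            (EckartYoung.detVariety dy dx r) P} =
          {P | ∃ I : Finset (Fin (min dy dx)), I.card = r ∧
            P = U * EckartYoung.rectDiagOn σ I * Vᵀ} := by
      ext P
      constructor
      · intro hP
        obtain ⟨hr, hl, hrt⟩ := hcrit P hP
        exact huniq P hr hl hrt
      · rintro ⟨I, hI, rfl⟩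
        exact (htr I hI).isCriticalOn
    have hlocal : ∀ P ∈ EckartYoung.detVariety dy dx r,
        IsLocalMinOn (EckartYoung.sqDist Q₀) (EckartYoung.detVariety dy dx r) P →
        P = U * EckartYoung.rectDiagOn σ (EckartYoung.firstIdx (min dy dx) r) * Vᵀ := by
      intro P hP hmin
      obtain ⟨hr, hl, hrt⟩ := hloc P hP hmin
      obtain ⟨I, hI, rfl⟩ := huniq P hr hl hrt
      have hle := (htr I hI).le_of_isLocalMinOn hmin
      -- Retained values dominate discarded ones; since `σ` is strictly decreasing, `I` is an
      -- initial segment.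
      have hI' : I = EckartYoung.firstIdx (min dy dx) r := by
        rw [← hI]
        refine EckartYoung.eq_firstIdx_of_isLowerSet fun i j hij hj => ?_
        by_contra hi
        have h1 := hinj (le_antisymm (hle j hj i hi) (hanti.antitone hij))
        exact hi (h1 ▸ hj)
      rw [← hI']
    refine ⟨hset, ?_, fun P hP => ⟨⟨hlocal P hP, ?_⟩, ⟨fun h => hlocal P hP h.localize, ?_⟩⟩, ?_⟩
    · have himg : {P | ∃ I : Finset (Fin (min dy dx)), I.card = r ∧
            P = U * EckartYoung.rectDiagOn σ I * Vᵀ} =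
          (fun I => U * EckartYoung.rectDiagOn σ I * Vᵀ) ''
            (Finset.powersetCard r (Finset.univ : Finset (Fin (min dy dx))) : Set _) := by
        ext P
        simp only [Set.mem_ofPred_eq, Set.mem_image, Finset.mem_coe, Finset.mem_powersetCard,
          Finset.subset_univ, true_and, eq_comm]
      have hinjOn : Function.Injective fun I : Finset (Fin (min dy dx)) =>
          U * EckartYoung.rectDiagOn σ I * Vᵀ := by
        intro I I' hII
        -- Conjugating back recovers the truncated diagonal, whose support is `I` because all `σ i`
        -- are positive.
        have h1 := congrArg (fun A => (EckartYoung.leftCols dx U)ᵀ * A *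
          EckartYoung.rightCols dy V) hII
        simp only [EckartYoung.rectDiagOn, EckartYoung.mul_rectDiag_mul] at h1
        rw [EckartYoung.conj_conj (EckartYoung.leftCols_orthonormal hsvd.left_orthogonal)
          (EckartYoung.rightCols_orthonormal hsvd.right_orthogonal),
          EckartYoung.conj_conj (EckartYoung.leftCols_orthonormal hsvd.left_orthogonal)
          (EckartYoung.rightCols_orthonormal hsvd.right_orthogonal)] at h1
        have h2 : EckartYoung.restrictTo σ I = EckartYoung.restrictTo σ I' :=
          diagonal_injective h1
        rw [← EckartYoung.filter_restrictTo_ne_zero (σ := σ) (I := I) fun i _ => hpos i, h2,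
          EckartYoung.filter_restrictTo_ne_zero fun i _ => hpos i]
      rw [hset, himg, Set.ncard_image_of_injective _ hinjOn, Set.ncard_coe_finset,
        Finset.card_powersetCard, Finset.card_univ, Fintype.card_fin]
    · rintro rfl
      exact (hglob U σ V hsvd).localize
    · rintro rfl
      exact hglob U σ V hsvd
    · intro I hI
      have h1 : ((I ×ˢ (Finset.univ \ I)).filter fun p => p.2 < p.1) =
          EckartYoung.IsTruncation.inversions σ I :=
        Finset.filter_congr fun p _ => (hanti.lt_iff_gt).symm
      rw [h1]
      exact (htr I hI).hasMorseIndex
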